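/- For $0<m<1$ let $K(m)=\int_0^{\pi/2}(1-m\sin^2\theta)^{-1/2}d\theta$ and $E(m)=\int_0^{\pi/2}(1-m\sin^2\theta)^{1/2}d\theta$ be the complete elliptic integrals of the first and second kind, put $m_1=1-m$, $K=K(m)$, $E=E(m)$, $K'=K(m_1)$, $E'=E(m_1)$, let $\operatorname{sn}(\cdot|m)$ and $\operatorname{dn}(\cdot|m)$ be the Jacobi elliptic functions with parameter $m$, and let $E(\sigma|m)=\int_0^\sigma \operatorname{dn}^2(s|m)\,ds$ (the residues of $\operatorname{dn}^2$ vanish, so the integral does not depend on the path). Let $a<b$ and $c>0$ be real, and set $\alpha=\frac{b-a}{2}$, $\beta=c$. There is exactly one $m\in(0,1)$ with $$\frac{E-m_1K}{\beta}=\frac{E'-mK'}{\alpha};$$ fix this $m$ and let $\lambda$ be the common value of the two sides. Let $\tilde\Phi=\phi_3\circ\phi_2\circ\phi_1$, where $\phi_1(\tilde z)=\tilde z-\frac{a+b}{2}$, $\phi_3(w)=\frac{i+w}{i-w}$, and $\phi_2:z\mapsto w$ is given through an auxiliary variable $\sigma$ in the open rectangle $\{-K<\operatorname{Re}\sigma<K,\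 0<\operatorname{Im}\sigma<2K'\}$ with the point $iK'$ (which corresponds to $z=\infty$) removed, by $$z=\alpha-\frac{i}{\lambda}\{E(\sigma|m)-m_1\sigma\},\qquad w=\frac{1-\operatorname{dn}(\sigma|m)}{\sqrt m\,\operatorname{sn}(\sigma|m)}.$$ Then $\tilde\Phi$ maps the exterior of the rectangle $[a,b]\times[-c,c]$ in $\mathbb{C}$ holomorphically and bijectively onto $\{u\in\mathbb{C}:|u|>1\}$. Let $\tilde\Psi$ be its inverse and, for $r>1$, let $C_r$ be the image of the circle $|u|=r$ under $\tilde\Psi$. Then for every $r>1$ $$\tilde\Psi(-r)=a-\frac1\lambda\int_0^{\frac12\left(r-\frac1r\right)}\frac{\sqrt{m+t^2}}{\sqrt{1+t^2}}\,dt ,$$ and $\tilde\Psi(-r)$, which is therefore real, is the unique leftmost point of $C_r$: $\min\{\operatorname{Re}\tilde z:\tilde z\in C_r\}=\tilde\Psi(-r)$, and $\operatorname{Re}\tilde z>\tilde\Psi(-r)$ for every other $\tilde z\in C_r$. -/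

import Mathlib

/-! ### Elliptic integrals (parameter `m = k²`, used for `0 < m < 1`) -/

/-- Incomplete elliptic integral of the first kind `F(φ, m)`, for a real amplitude `φ`. -/
noncomputable def ellipticF (φ m : ℝ) : ℝ :=
  ∫ θ in (0 : ℝ)..φ, 1 / √(1 - m * Real.sin θ ^ 2)

/-- Incomplete elliptic integral of the second kind `E(φ, m)`, for a real amplitude `φ`. -/
noncomputable def ellipticIncE (φ m : ℝ) : ℝ :=
  ∫ θ in (0 : ℝ)..φ, √(1 - m * Real.sin θ ^ 2)

/-- Complete elliptic integral of the first kind `K(m)`. -/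
noncomputable def completeK (m : ℝ) : ℝ := ellipticF (Real.pi / 2) m

/-- Complete elliptic integral of the second kind `E(m)`. -/
noncomputable def completeE (m : ℝ) : ℝ := ellipticIncE (Real.pi / 2) m

/-! ### Jacobi elliptic functions -/

/-- The amplitude: `φ = am(x | m)` is the solution of `F(φ, m) = x`; for `0 < m < 1` the map
`φ ↦ F(φ, m)` is an increasing bijection of `ℝ`. -/
noncomputable def jacobiAm (m x : ℝ) : ℝ := Function.invFun (fun φ : ℝ => ellipticF φ m) x

/-- `sn(x | m) = sin φ` for real `x = F(φ, m)`. -/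
noncomputable def realSn (m x : ℝ) : ℝ := Real.sin (jacobiAm m x)

/-- `cn(x | m) = cos φ` for real `x = F(φ, m)`. -/
noncomputable def realCn (m x : ℝ) : ℝ := Real.cos (jacobiAm m x)

/-- `dn(x | m) = √(1 - m sin² φ)` for real `x = F(φ, m)`. -/
noncomputable def realDn (m x : ℝ) : ℝ := √(1 - m * Real.sin (jacobiAm m x) ^ 2)

/-- Common denominator in the complex Jacobi functions; for `0 < m < 1` it vanishes exactly at
their poles `2 l K + (2 n + 1) i K'`. -/
noncomputable def jacobiDen (m : ℝ) (u : ℂ) : ℝ :=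
  realCn (1 - m) u.im ^ 2 + m * realSn m u.re ^ 2 * realSn (1 - m) u.im ^ 2

/-- The meromorphic function `sn(u | m)` of `u = x + iy`, which is the meromorphic continuation of
`sn` from the real line (Jacobi's imaginary transformation and addition theorem). -/
noncomputable def jacobiSn (m : ℝ) (u : ℂ) : ℂ :=
  ((realSn m u.re * realDn (1 - m) u.im : ℝ) +
    Complex.I * (realCn m u.re * realDn m u.re * realSn (1 - m) u.im * realCn (1 - m) u.im : ℝ))
    / (jacobiDen m u : ℝ)

/-- The meromorphic function `dn(u | m)` of `u = x + iy`. -/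
noncomputable def jacobiDn (m : ℝ) (u : ℂ) : ℂ :=
  ((realDn m u.re * realCn (1 - m) u.im * realDn (1 - m) u.im : ℝ) -
    Complex.I * (m * realSn m u.re * realCn m u.re * realSn (1 - m) u.im : ℝ))
    / (jacobiDen m u : ℝ)

/-- The integral of `f` along the straight segment from `p` to `q`. -/
noncomputable def segmentIntegral (f : ℂ → ℂ) (p q : ℂ) : ℂ :=
  ∫ t in (0 : ℝ)..1, f (p + (t : ℂ) * (q - p)) * (q - p)

/-- Jacobi's `E(σ | m) = ∫₀^σ dn²(s | m) ds`, for `|Re σ| ≤ K` and `σ` not a pole. The residues of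
`dn²` vanish, so the integral does not depend on the path; the straight segment from `0` to `σ` may
run through the pole `i K'`, so the path taken is the broken line `0 → K → σ` when `0 ≤ Re σ` and
`0 → -K → σ` when `Re σ < 0`, which meets no pole. -/
noncomputable def jacobiE (m : ℝ) (σ : ℂ) : ℂ :=
  let s : ℂ := if 0 ≤ σ.re then (completeK m : ℂ) else -(completeK m : ℂ)
  segmentIntegral (fun v => jacobiDn m v ^ 2) 0 s + segmentIntegral (fun v => jacobiDn m v ^ 2) s σ

/-! ### The conformal map of the exterior of `[a, b] × [-c, c]` -/

/-- The closed rectangle's exterior in the (finite) complex plane. -/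
def rectExterior (a b c : ℝ) : Set ℂ :=
  {z | ¬ (a ≤ z.re ∧ z.re ≤ b ∧ -c ≤ z.im ∧ z.im ≤ c)}

/-- `m ∈ (0, 1)` and `(E - m₁ K) / β = (E' - m K') / α`, where `α = (b - a) / 2`, `β = c`. -/
def IsRectParameter (a b c m : ℝ) : Prop :=
  0 < m ∧ m < 1 ∧
    (completeE m - (1 - m) * completeK m) / c =
      (completeE (1 - m) - m * completeK (1 - m)) / ((b - a) / 2)

/-- `λ`, the common ratio `(E - m₁ K) / β` with `β = c`. -/
noncomputable def rectLambda (c m : ℝ) : ℝ := (completeE m - (1 - m) * completeK m) / c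

/-- The range of the auxiliary variable `σ`: the open rectangle with vertices `±K`, `±K + 2 i K'`,
without the point `i K'`, which corresponds to `z = ∞`. -/
def sigmaDomain (m : ℝ) : Set ℂ :=
  {σ | -completeK m < σ.re ∧ σ.re < completeK m ∧
    0 < σ.im ∧ σ.im < 2 * completeK (1 - m) ∧ σ ≠ Complex.I * (completeK (1 - m) : ℂ)}

/-- `z = α - (i / λ) (E(σ | m) - m₁ σ)`, where `α = (b - a) / 2`. -/
noncomputable def zOfSigma (a b c m : ℝ) (σ : ℂ) : ℂ :=
  (((b - a) / 2 : ℝ) : ℂ) -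
    Complex.I / (rectLambda c m : ℂ) * (jacobiE m σ - ((1 - m : ℝ) : ℂ) * σ)

/-- `w = (1 - dn(σ | m)) / (√m sn(σ | m))`. -/
noncomputable def wOfSigma (m : ℝ) (σ : ℂ) : ℂ :=
  (1 - jacobiDn m σ) / ((√m : ℝ) * jacobiSn m σ)

/-- The shift `φ₁`. -/
noncomputable def phi₁ (a b : ℝ) (z : ℂ) : ℂ := z - (((a + b) / 2 : ℝ) : ℂ)

/-- The map `φ₂ : z ↦ w` through the auxiliary variable `σ`. -/
noncomputable def phi₂ (a b c m : ℝ) (z : ℂ) : ℂ :=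
  wOfSigma m (Function.invFunOn (zOfSigma a b c m) (sigmaDomain m) z)

/-- The Möbius map `φ₃`. -/
noncomputable def phi₃ (w : ℂ) : ℂ := (Complex.I + w) / (Complex.I - w)

/-- `Φ̃ = φ₃ ∘ φ₂ ∘ φ₁`. -/
noncomputable def rectPhi (a b c m : ℝ) : ℂ → ℂ := phi₃ ∘ phi₂ a b c m ∘ phi₁ a b

/-- `Ψ̃`, the inverse of `Φ̃` on the exterior of the rectangle. -/
noncomputable def rectPsi (a b c m : ℝ) : ℂ → ℂ :=
  Function.invFunOn (rectPhi a b c m) (rectExterior a b c)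

/-- The level curve `C_r`, the image of the circle `|u| = r` under `Ψ̃`. -/
def levelCurve (a b c m r : ℝ) : Set ℂ := rectPsi a b c m '' {u : ℂ | ‖u‖ = r}

/-!
The theorem becomes elementary in the coordinate `σ = x + iy` of the rectangle `|x| < K`,
`0 < y < 2K'`. Write `s, c, d` for `sn, cn, dn` at `x` with parameter `m`, and `s₁, c₁, d₁` for the
same functions at `y` with parameter `m₁`.

In this coordinate `Φ̃` is `dn - i √m sn`, since the Möbius map turns `w` into this function
(`phi₃_wOfSigma`). Its reciprocal `dn + i √m sn` equals `(d c₁ + i √m s) / (d₁ + √m c s₁)`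
(`diskCoord`), which is holomorphic on the closed rectangle, of square modulus
`(d₁ - √m c s₁) / (d₁ + √m c s₁)`; hence it is unimodular on the boundary. It is a bijection of the
open rectangle onto the unit disk (`bijOn_diskCoord`): injective by monotonicity of the real Jacobi
functions, and onto because it is open and proper (`surjOn_of_isPreconnected`).

The addition theorem and the imaginary transformation give `E(σ | m) - m₁ σ` a single-valued
closed form (`jacobiEps`), with derivative `dn² - m₁ = m cn²` by the Cauchy–Riemann equations. The
signs of `Re z` and `Im z` can be read off from it, and two reflections reduce everything to the
quarter `0 < x < K`, `0 < y < K'`, on which `Im cn² < 0`. There the increments of `jacobiEps` along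
segments stay in a half-plane that moves with the direction of the segment
(`re_mul_sub_mul_conj_pos`). This gives injectivity, and, applied to segments from the corner `K`,
that the image avoids the rectangle. Surjectivity is again openness and properness, as `jacobiEps`
has a pole at `iK'` (`bijOn_jacobiEps`).

The equation for `m` says that `α N(m) = β N(1 - m)`, where
`N(m) = ∫₀^{π/2} m cos² θ (1 - m sin² θ)^{-1/2} dθ` is continuous and strictly increasing on
`[0, 1]` with `N(0) = 0` (`existsUnique_isRectParameter`).

The point `u = -r` lies on the segment `x = 0`, `K' < y < 2K'`, on which the integral formula is the
substitution `t = √m s₁ / c₁` after a reflection (`rectPsi_neg`). Finally `dz / d(log u)` is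
`(√m / λ) cn`, so the derivative of `Re z` along a circle `|u| = r` is a multiple of `Im cn`, whose
sign is that of `-s`; therefore `Re z` is strictly monotone on each of the two arcs from `u = r` to
`u = -r` (`lt_re_rectPoint`).
-/

/-! ### Real Jacobi functions -/

lemma one_sub_mem_Ioo {m : ℝ} (hm : m ∈ Set.Ioo (0 : ℝ) 1) : 1 - m ∈ Set.Ioo (0 : ℝ) 1 :=
  ⟨by linarith [hm.2], by linarith [hm.1]⟩

lemma one_sub_mul_sin_sq_pos {m : ℝ} (hm : m ∈ Set.Ioo (0 : ℝ) 1) (φ : ℝ) :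
    0 < 1 - m * Real.sin φ ^ 2 := by
  nlinarith [Real.sin_sq_le_one φ, hm.1, hm.2]

lemma hasDerivAt_ellipticF {m : ℝ} (hm : m ∈ Set.Ioo (0 : ℝ) 1) (φ : ℝ) :
    HasDerivAt (fun φ => ellipticF φ m) (1 / √(1 - m * Real.sin φ ^ 2)) φ := by
  have hc : Continuous fun θ : ℝ => 1 / √(1 - m * Real.sin θ ^ 2) := by
    refine Continuous.div continuous_const (by fun_prop) fun θ => ?_
    exact (Real.sqrt_pos.2 (one_sub_mul_sin_sq_pos hm θ)).ne'
  exact intervalIntegral.integral_hasDerivAt_right (hc.intervalIntegrable _ _)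
    hc.aestronglyMeasurable.stronglyMeasurableAtFilter hc.continuousAt

lemma hasDerivAt_ellipticIncE (m φ : ℝ) :
    HasDerivAt (fun φ => ellipticIncE φ m) (√(1 - m * Real.sin φ ^ 2)) φ := by
  have hc : Continuous fun θ : ℝ => √(1 - m * Real.sin θ ^ 2) := by fun_prop
  exact intervalIntegral.integral_hasDerivAt_right (hc.intervalIntegrable _ _)
    hc.aestronglyMeasurable.stronglyMeasurableAtFilter hc.continuousAt

lemma ellipticF_zero (m : ℝ) : ellipticF 0 m = 0 := by simp [ellipticF]

lemma ellipticIncE_zero (m : ℝ) : ellipticIncE 0 m = 0 := by simp [ellipticIncE]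

lemma ellipticF_neg (φ m : ℝ) : ellipticF (-φ) m = -ellipticF φ m := by
  have h := intervalIntegral.integral_comp_neg (a := 0) (b := φ)
    fun θ : ℝ => 1 / √(1 - m * Real.sin θ ^ 2)
  rw [neg_zero, intervalIntegral.integral_symm 0 (-φ)] at h
  simp only [Real.sin_neg, neg_sq] at h
  unfold ellipticF
  linarith

lemma ellipticIncE_neg (φ m : ℝ) : ellipticIncE (-φ) m = -ellipticIncE φ m := by
  have h := intervalIntegral.integral_comp_neg (a := 0) (b := φ)
    fun θ : ℝ => √(1 - m * Real.sin θ ^ 2)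
  rw [neg_zero, intervalIntegral.integral_symm 0 (-φ)] at h
  simp only [Real.sin_neg, neg_sq] at h
  unfold ellipticIncE
  linarith

lemma strictMono_ellipticF {m : ℝ} (hm : m ∈ Set.Ioo (0 : ℝ) 1) :
    StrictMono fun φ => ellipticF φ m :=
  strictMono_of_hasDerivAt_pos (hasDerivAt_ellipticF hm) fun φ =>
    one_div_pos.2 (Real.sqrt_pos.2 (one_sub_mul_sin_sq_pos hm φ))

lemma surjective_ellipticF {m : ℝ} (hm : m ∈ Set.Ioo (0 : ℝ) 1) :
    Function.Surjective fun φ => ellipticF φ m := by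
  -- The integrand is at least `1`, so `F(φ) - φ` is monotone.
  have hmono : Monotone fun φ => ellipticF φ m - φ := by
    refine monotone_of_deriv_nonneg
      (fun φ => ((hasDerivAt_ellipticF hm φ).fun_sub (hasDerivAt_id' φ)).differentiableAt)
      fun φ => ?_
    rw [((hasDerivAt_ellipticF hm φ).fun_sub (hasDerivAt_id' φ)).deriv, sub_nonneg,
      le_div_iff₀ (Real.sqrt_pos.2 (one_sub_mul_sin_sq_pos hm φ)), one_mul, Real.sqrt_le_one]
    nlinarith [sq_nonneg (Real.sin φ), hm.1]
  have hcont : Continuous fun φ => ellipticF φ m :=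
    continuous_iff_continuousAt.2 fun φ => (hasDerivAt_ellipticF hm φ).continuousAt
  refine hcont.surjective ?_ ?_
  · refine Filter.tendsto_atTop_mono' _ ?_ Filter.tendsto_id
    filter_upwards [Filter.eventually_ge_atTop 0] with φ hφ
    have := hmono hφ
    simp only [ellipticF_zero] at this
    simp only [id]; linarith
  · refine Filter.tendsto_atBot_mono' _ ?_ Filter.tendsto_id
    filter_upwards [Filter.eventually_le_atBot 0] with φ hφ
    have := hmono hφ
    simp only [ellipticF_zero] at this
    simp only [id]; linarith

lemma ellipticF_jacobiAm {m : ℝ} (hm : m ∈ Set.Ioo (0 : ℝ) 1) (x : ℝ) :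
    ellipticF (jacobiAm m x) m = x :=
  Function.rightInverse_invFun (surjective_ellipticF hm) x

lemma jacobiAm_ellipticF {m : ℝ} (hm : m ∈ Set.Ioo (0 : ℝ) 1) (φ : ℝ) :
    jacobiAm m (ellipticF φ m) = φ :=
  Function.leftInverse_invFun (strictMono_ellipticF hm).injective φ

lemma strictMono_jacobiAm {m : ℝ} (hm : m ∈ Set.Ioo (0 : ℝ) 1) : StrictMono (jacobiAm m) := by
  intro x y hxy
  rw [← (strictMono_ellipticF hm).lt_iff_lt]
  simpa only [ellipticF_jacobiAm hm] using hxy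

lemma hasDerivAt_jacobiAm {m : ℝ} (hm : m ∈ Set.Ioo (0 : ℝ) 1) (x : ℝ) :
    HasDerivAt (jacobiAm m) (realDn m x) x := by
  have hcont : Continuous (jacobiAm m) :=
    (strictMono_jacobiAm hm).monotone.continuous_of_surjective
      fun φ => ⟨_, jacobiAm_ellipticF hm φ⟩
  have h := HasDerivAt.of_local_left_inverse hcont.continuousAt
    (hasDerivAt_ellipticF hm (jacobiAm m x))
    (one_div_pos.2 (Real.sqrt_pos.2 (one_sub_mul_sin_sq_pos hm _))).ne'
    (Filter.Eventually.of_forall (ellipticF_jacobiAm hm))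
  simpa [realDn] using h

lemma jacobiAm_zero {m : ℝ} (hm : m ∈ Set.Ioo (0 : ℝ) 1) : jacobiAm m 0 = 0 := by
  simpa [ellipticF_zero] using jacobiAm_ellipticF hm 0

lemma jacobiAm_completeK {m : ℝ} (hm : m ∈ Set.Ioo (0 : ℝ) 1) :
    jacobiAm m (completeK m) = Real.pi / 2 :=
  jacobiAm_ellipticF hm _

lemma jacobiAm_neg {m : ℝ} (hm : m ∈ Set.Ioo (0 : ℝ) 1) (x : ℝ) :
    jacobiAm m (-x) = -jacobiAm m x := by
  refine (strictMono_ellipticF hm).injective ?_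
  simp only [ellipticF_neg, ellipticF_jacobiAm hm]

lemma ellipticF_pi_sub {m : ℝ} (hm : m ∈ Set.Ioo (0 : ℝ) 1) (φ : ℝ) :
    ellipticF (Real.pi - φ) m = 2 * completeK m - ellipticF φ m := by
  have hc : Continuous fun θ : ℝ => 1 / √(1 - m * Real.sin θ ^ 2) := by
    refine Continuous.div continuous_const (by fun_prop) fun θ => ?_
    exact (Real.sqrt_pos.2 (one_sub_mul_sin_sq_pos hm θ)).ne'
  have h := intervalIntegral.integral_comp_sub_left (a := Real.pi / 2) (b := φ)
    (fun θ : ℝ => 1 / √(1 - m * Real.sin θ ^ 2)) Real.pi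
  simp only [Real.sin_pi_sub] at h
  rw [show Real.pi - Real.pi / 2 = Real.pi / 2 by ring] at h
  have h1 := intervalIntegral.integral_add_adjacent_intervals
    (hc.intervalIntegrable (μ := MeasureTheory.volume) 0 (Real.pi / 2))
    (hc.intervalIntegrable (Real.pi / 2) φ)
  have h2 := intervalIntegral.integral_add_adjacent_intervals
    (hc.intervalIntegrable (μ := MeasureTheory.volume) 0 (Real.pi - φ))
    (hc.intervalIntegrable (Real.pi - φ) (Real.pi / 2))
  unfold completeK ellipticF
  linarith

lemma ellipticIncE_pi_sub (φ m : ℝ) :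
    ellipticIncE (Real.pi - φ) m = 2 * completeE m - ellipticIncE φ m := by
  have hc : Continuous fun θ : ℝ => √(1 - m * Real.sin θ ^ 2) := by fun_prop
  have h := intervalIntegral.integral_comp_sub_left (a := Real.pi / 2) (b := φ)
    (fun θ : ℝ => √(1 - m * Real.sin θ ^ 2)) Real.pi
  simp only [Real.sin_pi_sub] at h
  rw [show Real.pi - Real.pi / 2 = Real.pi / 2 by ring] at h
  have h1 := intervalIntegral.integral_add_adjacent_intervals
    (hc.intervalIntegrable (μ := MeasureTheory.volume) 0 (Real.pi / 2))
    (hc.intervalIntegrable (Real.pi / 2) φ)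
  have h2 := intervalIntegral.integral_add_adjacent_intervals
    (hc.intervalIntegrable (μ := MeasureTheory.volume) 0 (Real.pi - φ))
    (hc.intervalIntegrable (Real.pi - φ) (Real.pi / 2))
  unfold completeE ellipticIncE
  linarith

lemma jacobiAm_two_mul_completeK_sub {m : ℝ} (hm : m ∈ Set.Ioo (0 : ℝ) 1) (x : ℝ) :
    jacobiAm m (2 * completeK m - x) = Real.pi - jacobiAm m x := by
  refine (strictMono_ellipticF hm).injective ?_
  simp only [ellipticF_pi_sub hm, ellipticF_jacobiAm hm]

/-- Jacobi's `E(x | m) = ∫₀ˣ dn²` for real `x`, as the incomplete integral at the amplitude. -/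
noncomputable def realE (m x : ℝ) : ℝ := ellipticIncE (jacobiAm m x) m

lemma realSn_sq_add_realCn_sq (m x : ℝ) : realSn m x ^ 2 + realCn m x ^ 2 = 1 :=
  Real.sin_sq_add_cos_sq _

lemma realDn_pos {m : ℝ} (hm : m ∈ Set.Ioo (0 : ℝ) 1) (x : ℝ) : 0 < realDn m x :=
  Real.sqrt_pos.2 (one_sub_mul_sin_sq_pos hm _)

lemma realDn_sq {m : ℝ} (hm : m ∈ Set.Ioo (0 : ℝ) 1) (x : ℝ) :
    realDn m x ^ 2 = 1 - m * realSn m x ^ 2 :=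
  Real.sq_sqrt (one_sub_mul_sin_sq_pos hm _).le

lemma hasDerivAt_realSn {m : ℝ} (hm : m ∈ Set.Ioo (0 : ℝ) 1) (x : ℝ) :
    HasDerivAt (realSn m) (realCn m x * realDn m x) x :=
  (hasDerivAt_jacobiAm hm x).sin

lemma hasDerivAt_realCn {m : ℝ} (hm : m ∈ Set.Ioo (0 : ℝ) 1) (x : ℝ) :
    HasDerivAt (realCn m) (-(realSn m x * realDn m x)) x :=
  (hasDerivAt_jacobiAm hm x).cos.congr_deriv (neg_mul _ _)

lemma hasDerivAt_realDn {m : ℝ} (hm : m ∈ Set.Ioo (0 : ℝ) 1) (x : ℝ) :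
    HasDerivAt (realDn m) (-(m * realSn m x * realCn m x)) x := by
  have h := ((((hasDerivAt_realSn hm x).pow 2).const_mul m).const_sub 1).sqrt
    (one_sub_mul_sin_sq_pos hm _).ne'
  refine h.congr_deriv ?_
  have hd := (realDn_pos hm x).ne'
  change _ / (2 * realDn m x) = _
  field_simp
  norm_num
  try ring

lemma hasDerivAt_realE {m : ℝ} (hm : m ∈ Set.Ioo (0 : ℝ) 1) (x : ℝ) :
    HasDerivAt (realE m) (realDn m x ^ 2) x := by
  have h := (hasDerivAt_ellipticIncE m (jacobiAm m x)).comp x (hasDerivAt_jacobiAm hm x)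
  rw [sq]
  exact h

section Values

variable {m : ℝ} (hm : m ∈ Set.Ioo (0 : ℝ) 1)
include hm

lemma realSn_zero : realSn m 0 = 0 := by simp [realSn, jacobiAm_zero hm]

lemma realCn_zero : realCn m 0 = 1 := by simp [realCn, jacobiAm_zero hm]

lemma realDn_zero : realDn m 0 = 1 := by simp [realDn, jacobiAm_zero hm]

lemma realE_zero : realE m 0 = 0 := by simp [realE, jacobiAm_zero hm, ellipticIncE_zero]

lemma realSn_completeK : realSn m (completeK m) = 1 := by simp [realSn, jacobiAm_completeK hm]

lemma realCn_completeK : realCn m (completeK m) = 0 := by simp [realCn, jacobiAm_completeK hm]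

lemma realE_completeK : realE m (completeK m) = completeE m := by
  simp [realE, jacobiAm_completeK hm, completeE]

lemma realSn_neg (x : ℝ) : realSn m (-x) = -realSn m x := by simp [realSn, jacobiAm_neg hm]

lemma realCn_neg (x : ℝ) : realCn m (-x) = realCn m x := by simp [realCn, jacobiAm_neg hm]

lemma realDn_neg (x : ℝ) : realDn m (-x) = realDn m x := by simp [realDn, jacobiAm_neg hm]

lemma realE_neg (x : ℝ) : realE m (-x) = -realE m x := by
  simp [realE, jacobiAm_neg hm, ellipticIncE_neg]

lemma realSn_two_mul_completeK_sub (x : ℝ) : realSn m (2 * completeK m - x) = realSn m x := by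
  simp [realSn, jacobiAm_two_mul_completeK_sub hm, Real.sin_pi_sub]

lemma realCn_two_mul_completeK_sub (x : ℝ) : realCn m (2 * completeK m - x) = -realCn m x := by
  simp [realCn, jacobiAm_two_mul_completeK_sub hm, Real.cos_pi_sub]

lemma realDn_two_mul_completeK_sub (x : ℝ) : realDn m (2 * completeK m - x) = realDn m x := by
  simp [realDn, jacobiAm_two_mul_completeK_sub hm, Real.sin_pi_sub]

lemma realE_two_mul_completeK_sub (x : ℝ) :
    realE m (2 * completeK m - x) = 2 * completeE m - realE m x := by
  simp [realE, jacobiAm_two_mul_completeK_sub hm, ellipticIncE_pi_sub]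

lemma completeK_pos : 0 < completeK m := by
  have h := strictMono_ellipticF hm (show (0 : ℝ) < Real.pi / 2 by positivity)
  dsimp only at h
  rwa [ellipticF_zero] at h

lemma realSn_pos {x : ℝ} (h0 : 0 < x) (h1 : x < 2 * completeK m) : 0 < realSn m x := by
  refine Real.sin_pos_of_pos_of_lt_pi ?_ ?_
  · simpa only [jacobiAm_zero hm] using strictMono_jacobiAm hm h0
  · have h := strictMono_jacobiAm hm (show 0 < 2 * completeK m - x by linarith)
    rw [jacobiAm_zero hm, jacobiAm_two_mul_completeK_sub hm] at h
    linarith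

lemma realCn_pos {x : ℝ} (h0 : -completeK m < x) (h1 : x < completeK m) : 0 < realCn m x := by
  refine Real.cos_pos_of_mem_Ioo ⟨?_, ?_⟩
  · simpa only [jacobiAm_neg hm, jacobiAm_completeK hm] using strictMono_jacobiAm hm h0
  · simpa only [jacobiAm_completeK hm] using strictMono_jacobiAm hm h1

lemma realSn_nonneg {x : ℝ} (h0 : 0 ≤ x) (h1 : x ≤ 2 * completeK m) : 0 ≤ realSn m x := by
  rcases h0.eq_or_lt with rfl | h0
  · rw [realSn_zero hm]
  rcases h1.eq_or_lt with rfl | h1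
  · rw [← sub_zero (2 * completeK m), realSn_two_mul_completeK_sub hm, realSn_zero hm]
  exact (realSn_pos hm h0 h1).le

lemma realCn_nonneg {x : ℝ} (h0 : -completeK m ≤ x) (h1 : x ≤ completeK m) :
    0 ≤ realCn m x := by
  rcases h0.eq_or_lt with rfl | h0
  · rw [realCn_neg hm, realCn_completeK hm]
  rcases h1.eq_or_lt with rfl | h1
  · rw [realCn_completeK hm]
  exact (realCn_pos hm h0 h1).le

/-- `cn` is strictly decreasing on `[0, 2K]`. -/
lemma realCn_lt_realCn {x y : ℝ} (hx : 0 ≤ x) (hxy : x < y) (hy : y ≤ 2 * completeK m) :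
    realCn m y < realCn m x := by
  refine Real.cos_lt_cos_of_nonneg_of_le_pi ?_ ?_ (strictMono_jacobiAm hm hxy)
  · simpa only [jacobiAm_zero hm] using (strictMono_jacobiAm hm).monotone hx
  · have h := (strictMono_jacobiAm hm).monotone (show 0 ≤ 2 * completeK m - y by linarith)
    rw [jacobiAm_zero hm, jacobiAm_two_mul_completeK_sub hm] at h
    linarith

end Values

/-! ### The Jacobi functions of a complex variable -/

/-- The Cauchy–Riemann criterion in terms of the partial derivatives of real and imaginary part. -/
lemma hasDerivAt_of_cauchyRiemann {A B : ℝ → ℝ → ℝ} {σ : ℂ} {p q : ℝ}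
    (hA : DifferentiableAt ℝ (fun τ : ℂ => A τ.re τ.im) σ)
    (hB : DifferentiableAt ℝ (fun τ : ℂ => B τ.re τ.im) σ)
    (hAx : HasDerivAt (fun x => A x σ.im) p σ.re) (hAy : HasDerivAt (fun y => A σ.re y) (-q) σ.im)
    (hBx : HasDerivAt (fun x => B x σ.im) q σ.re) (hBy : HasDerivAt (fun y => B σ.re y) p σ.im) :
    HasDerivAt (fun τ : ℂ => (A τ.re τ.im : ℂ) + Complex.I * (B τ.re τ.im : ℂ))
      (p + Complex.I * q) σ := by
  have hX : HasDerivAt (fun x : ℝ => (x : ℂ) + σ.im * Complex.I) 1 σ.re :=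
    (HasDerivAt.ofReal_comp (hasDerivAt_id' σ.re)).add_const _
  have hY : HasDerivAt (fun y : ℝ => (σ.re : ℂ) + y * Complex.I) Complex.I σ.im := by
    simpa using ((HasDerivAt.ofReal_comp (hasDerivAt_id' σ.im)).mul_const Complex.I).const_add
      (σ.re : ℂ)
  have key : ∀ {C : ℝ → ℝ → ℝ} {r s : ℝ}, DifferentiableAt ℝ (fun τ : ℂ => C τ.re τ.im) σ →
      HasDerivAt (fun x => C x σ.im) r σ.re → HasDerivAt (fun y => C σ.re y) s σ.im →
      HasFDerivAt (fun τ : ℂ => C τ.re τ.im) (r • Complex.reCLM + s • Complex.imCLM) σ := by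
    intro C r s hC hx hy
    have hF := hC.hasFDerivAt
    set L := fderiv ℝ (fun τ : ℂ => C τ.re τ.im) σ with hL
    have e : ((σ.re : ℂ) + σ.im * Complex.I) = σ := Complex.re_add_im σ
    have h1 : L 1 = r := by
      have h := HasFDerivAt.comp_hasDerivAt σ.re (by rwa [e]) hX (l := fun τ : ℂ => C τ.re τ.im)
      refine h.unique (hx.congr_of_eventuallyEq (Filter.Eventually.of_forall fun x => ?_))
      simp
    have h2 : L Complex.I = s := by
      have h := HasFDerivAt.comp_hasDerivAt σ.im (by rwa [e]) hY (l := fun τ : ℂ => C τ.re τ.im)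
      refine h.unique (hy.congr_of_eventuallyEq (Filter.Eventually.of_forall fun x => ?_))
      simp
    have : L = r • Complex.reCLM + s • Complex.imCLM := by
      ext τ
      have hτ : τ = τ.re • (1 : ℂ) + τ.im • Complex.I := by simp
      rw [hτ, map_add, map_smul, map_smul, h1, h2]
      simp [mul_comm]
    rwa [this] at hF
  have hA' := key hA hAx hAy
  have hB' := key hB hBx hBy
  have h1 := Complex.ofRealCLM.hasFDerivAt.comp σ hA'
  have h2 := (Complex.ofRealCLM.hasFDerivAt.comp σ hB').const_smul Complex.I
  have h3 := h1.add h2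
  rw [hasDerivAt_iff_hasFDerivAt]
  refine hasFDerivAt_of_restrictScalars ℝ h3 ?_
  ext τ
  apply Complex.ext <;> simp <;> ring

/-- The meromorphic function `cn(u | m)` of `u = x + iy`. -/
noncomputable def jacobiCn (m : ℝ) (u : ℂ) : ℂ :=
  ((realCn m u.re * realCn (1 - m) u.im : ℝ) -
    Complex.I * (realSn m u.re * realDn m u.re * realSn (1 - m) u.im * realDn (1 - m) u.im : ℝ))
    / (jacobiDen m u : ℝ)

/-- The denominator of `diskCoord`. -/
noncomputable def diskDen (m : ℝ) (σ : ℂ) : ℝ :=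
  realDn (1 - m) σ.im + √m * realCn m σ.re * realSn (1 - m) σ.im

/-- The function `dn + i √m sn = 1 / (dn - i √m sn)`, written without common factors. It maps the
rectangle `|Re σ| < K`, `0 < Im σ < 2K'` onto the unit disk, and `iK'` to `0`. -/
noncomputable def diskCoord (m : ℝ) (σ : ℂ) : ℂ :=
  ((realDn m σ.re * realCn (1 - m) σ.im / diskDen m σ : ℝ) : ℂ) +
    Complex.I * ((√m * realSn m σ.re / diskDen m σ : ℝ) : ℂ)

/-- The derivative of `diskCoord`; it is `i √m cn · diskCoord` away from the poles of `cn`. -/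
noncomputable def diskCoordDeriv (m : ℝ) (σ : ℂ) : ℂ :=
  ((-(√m * (realSn m σ.re * realCn (1 - m) σ.im *
      (√m * realCn m σ.re * realDn (1 - m) σ.im - (1 - m) * realSn (1 - m) σ.im)) /
      diskDen m σ ^ 2) : ℝ) : ℂ) +
    Complex.I * ((√m * (realDn m σ.re * (realCn m σ.re * realDn (1 - m) σ.im +
      √m * realSn (1 - m) σ.im)) / diskDen m σ ^ 2 : ℝ) : ℂ)

/-- The real part of `E(σ | m) - m₁ σ`. -/
noncomputable def epsRe (m x y : ℝ) : ℝ :=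
  realE m x - (1 - m) * x +
    m * realSn m x * realCn m x * realDn m x * realSn (1 - m) y ^ 2 /
      (realCn (1 - m) y ^ 2 + m * realSn m x ^ 2 * realSn (1 - m) y ^ 2)

/-- The imaginary part of `E(σ | m) - m₁ σ`. -/
noncomputable def epsIm (m x y : ℝ) : ℝ :=
  m * y - realE (1 - m) y +
    realSn (1 - m) y * realCn (1 - m) y * realDn (1 - m) y * realDn m x ^ 2 /
      (realCn (1 - m) y ^ 2 + m * realSn m x ^ 2 * realSn (1 - m) y ^ 2)

/-- The function `E(σ | m) - m₁ σ`, a single-valued primitive of `m cn²`, split into real and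
imaginary part by the addition theorem and the imaginary transformation for `E`. -/
noncomputable def jacobiEps (m : ℝ) (σ : ℂ) : ℂ :=
  (epsRe m σ.re σ.im : ℂ) + Complex.I * (epsIm m σ.re σ.im : ℂ)

lemma DifferentiableAt.real_div {f g : ℂ → ℝ} {σ : ℂ} (hf : DifferentiableAt ℝ f σ)
    (hg : DifferentiableAt ℝ g σ) (h : g σ ≠ 0) : DifferentiableAt ℝ (fun τ => f τ / g τ) σ := by
  simpa only [div_eq_mul_inv] using hf.fun_mul (hg.fun_inv h)

section

variable {m : ℝ} (hm : m ∈ Set.Ioo (0 : ℝ) 1)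
include hm

lemma differentiableAt_realSn_re (σ : ℂ) : DifferentiableAt ℝ (fun τ : ℂ => realSn m τ.re) σ :=
  (hasDerivAt_realSn hm σ.re).differentiableAt.comp σ Complex.reCLM.differentiableAt

lemma differentiableAt_realCn_re (σ : ℂ) : DifferentiableAt ℝ (fun τ : ℂ => realCn m τ.re) σ :=
  (hasDerivAt_realCn hm σ.re).differentiableAt.comp σ Complex.reCLM.differentiableAt

lemma differentiableAt_realDn_re (σ : ℂ) : DifferentiableAt ℝ (fun τ : ℂ => realDn m τ.re) σ :=
  (hasDerivAt_realDn hm σ.re).differentiableAt.comp σ Complex.reCLM.differentiableAt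

lemma differentiableAt_realE_re (σ : ℂ) : DifferentiableAt ℝ (fun τ : ℂ => realE m τ.re) σ :=
  (hasDerivAt_realE hm σ.re).differentiableAt.comp σ Complex.reCLM.differentiableAt

lemma differentiableAt_realSn_im (σ : ℂ) : DifferentiableAt ℝ (fun τ : ℂ => realSn m τ.im) σ :=
  (hasDerivAt_realSn hm σ.im).differentiableAt.comp σ Complex.imCLM.differentiableAt

lemma differentiableAt_realCn_im (σ : ℂ) : DifferentiableAt ℝ (fun τ : ℂ => realCn m τ.im) σ :=
  (hasDerivAt_realCn hm σ.im).differentiableAt.comp σ Complex.imCLM.differentiableAt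

lemma differentiableAt_realDn_im (σ : ℂ) : DifferentiableAt ℝ (fun τ : ℂ => realDn m τ.im) σ :=
  (hasDerivAt_realDn hm σ.im).differentiableAt.comp σ Complex.imCLM.differentiableAt

lemma differentiableAt_realE_im (σ : ℂ) : DifferentiableAt ℝ (fun τ : ℂ => realE m τ.im) σ :=
  (hasDerivAt_realE hm σ.im).differentiableAt.comp σ Complex.imCLM.differentiableAt

lemma hasDerivAt_diskCoord {σ : ℂ} (hσ : diskDen m σ ≠ 0) :
    HasDerivAt (diskCoord m) (diskCoordDeriv m σ) σ := by
  have hm' := one_sub_mem_Ioo hm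
  have hs := hasDerivAt_realSn hm σ.re
  have hc := hasDerivAt_realCn hm σ.re
  have hd := hasDerivAt_realDn hm σ.re
  have hs' := hasDerivAt_realSn hm' σ.im
  have hc' := hasDerivAt_realCn hm' σ.im
  have hd' := hasDerivAt_realDn hm' σ.im
  have e1 := realSn_sq_add_realCn_sq m σ.re
  have e2 := realDn_sq hm σ.re
  have e3 := realSn_sq_add_realCn_sq (1 - m) σ.im
  have e4 := realDn_sq hm' σ.im
  have e5 : √m ^ 2 = m := Real.sq_sqrt hm.1.le
  have hP : DifferentiableAt ℝ (fun τ : ℂ => realDn (1 - m) τ.im +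
      √m * realCn m τ.re * realSn (1 - m) τ.im) σ :=
    (differentiableAt_realDn_im hm' σ).fun_add
      (((differentiableAt_realCn_re hm σ).const_mul _).fun_mul (differentiableAt_realSn_im hm' σ))
  have hσ' := hσ
  unfold diskDen at hσ'
  unfold diskCoord diskCoordDeriv diskDen
  refine hasDerivAt_of_cauchyRiemann
    (A := fun x y => realDn m x * realCn (1 - m) y /
      (realDn (1 - m) y + √m * realCn m x * realSn (1 - m) y))
    (B := fun x y => √m * realSn m x / (realDn (1 - m) y + √m * realCn m x * realSn (1 - m) y))
    ?_ ?_ ?_ ?_ ?_ ?_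
  · exact ((differentiableAt_realDn_re hm σ).fun_mul (differentiableAt_realCn_im hm' σ)).real_div
      hP hσ'
  · exact ((differentiableAt_realSn_re hm σ).const_mul _).real_div hP hσ'
  · refine ((hd.mul_const _).fun_div (((hc.const_mul _).mul_const _).const_add _)
      hσ').congr_deriv ?_
    rw [← neg_div, div_left_inj' (pow_ne_zero 2 hσ')]
    clear hs hc hd hs' hc' hd' hP
    grind
  · refine ((hc'.const_mul _).fun_div (hd'.fun_add (hs'.const_mul _)) hσ').congr_deriv ?_
    rw [← neg_div, div_left_inj' (pow_ne_zero 2 hσ')]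
    clear hs hc hd hs' hc' hd' hP
    grind
  · refine ((hs.const_mul _).fun_div (((hc.const_mul _).mul_const _).const_add _)
      hσ').congr_deriv ?_
    rw [div_left_inj' (pow_ne_zero 2 hσ')]
    clear hs hc hd hs' hc' hd' hP
    grind
  · refine ((hasDerivAt_const _ _).fun_div (hd'.fun_add (hs'.const_mul _)) hσ').congr_deriv ?_
    rw [← neg_div, div_left_inj' (pow_ne_zero 2 hσ')]
    clear hs hc hd hs' hc' hd' hP
    grind

omit hm in
/-- Real and imaginary part of `m cn²`. -/
lemma mul_jacobiCn_sq (m : ℝ) (σ : ℂ) :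
    (m : ℂ) * jacobiCn m σ ^ 2 =
      ((m * ((realCn m σ.re * realCn (1 - m) σ.im) ^ 2 -
        (realSn m σ.re * realDn m σ.re * realSn (1 - m) σ.im * realDn (1 - m) σ.im) ^ 2) /
          jacobiDen m σ ^ 2 : ℝ) : ℂ) + Complex.I *
      ((-(2 * m * (realCn m σ.re * realCn (1 - m) σ.im) *
        (realSn m σ.re * realDn m σ.re * realSn (1 - m) σ.im * realDn (1 - m) σ.im)) /
          jacobiDen m σ ^ 2 : ℝ) : ℂ) := by
  unfold jacobiCn
  rw [div_pow]
  push_cast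
  ring_nf
  simp only [Complex.I_sq]
  ring

lemma hasDerivAt_jacobiEps {σ : ℂ} (hσ : jacobiDen m σ ≠ 0) :
    HasDerivAt (jacobiEps m) (m * jacobiCn m σ ^ 2) σ := by
  have hm' := one_sub_mem_Ioo hm
  have hs := hasDerivAt_realSn hm σ.re
  have hc := hasDerivAt_realCn hm σ.re
  have hd := hasDerivAt_realDn hm σ.re
  have hE := hasDerivAt_realE hm σ.re
  have hs' := hasDerivAt_realSn hm' σ.im
  have hc' := hasDerivAt_realCn hm' σ.im
  have hd' := hasDerivAt_realDn hm' σ.im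
  have hE' := hasDerivAt_realE hm' σ.im
  have e1 := realSn_sq_add_realCn_sq m σ.re
  have e2 := realDn_sq hm σ.re
  have e3 := realSn_sq_add_realCn_sq (1 - m) σ.im
  have e4 := realDn_sq hm' σ.im
  have Hs := differentiableAt_realSn_re hm σ
  have Hc := differentiableAt_realCn_re hm σ
  have Hd := differentiableAt_realDn_re hm σ
  have Hs' := differentiableAt_realSn_im hm' σ
  have Hc' := differentiableAt_realCn_im hm' σ
  have Hd' := differentiableAt_realDn_im hm' σ
  have HD : DifferentiableAt ℝ (jacobiDen m) σ :=
    (Hc'.fun_pow 2).fun_add (((Hs.fun_pow 2).const_mul m).fun_mul (Hs'.fun_pow 2))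
  have hDx := ((hs.fun_pow 2).const_mul m).mul_const (realSn (1 - m) σ.im ^ 2)|>.const_add
    (realCn (1 - m) σ.im ^ 2)
  have hDy := (hc'.fun_pow 2).fun_add ((hs'.fun_pow 2).const_mul (m * realSn m σ.re ^ 2))
  rw [mul_jacobiCn_sq]
  have hD : jacobiDen m σ =
    realCn (1 - m) σ.im ^ 2 + m * realSn m σ.re ^ 2 * realSn (1 - m) σ.im ^ 2 := rfl
  refine hasDerivAt_of_cauchyRiemann (A := epsRe m) (B := epsIm m) ?_ ?_ ?_ ?_ ?_ ?_
  · exact ((differentiableAt_realE_re hm σ).fun_sub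
      (Complex.reCLM.differentiableAt.const_mul _)).fun_add
      (((((Hs.const_mul m).fun_mul Hc).fun_mul Hd).fun_mul (Hs'.fun_pow 2)).real_div HD hσ)
  · exact ((Complex.imCLM.differentiableAt.const_mul _).fun_sub
      (differentiableAt_realE_im hm' σ)).fun_add
      ((((Hs'.fun_mul Hc').fun_mul Hd').fun_mul (Hd.fun_pow 2)).real_div HD hσ)
  · refine ((hE.fun_sub ((hasDerivAt_id' _).const_mul (1 - m))).fun_add
      (((((hs.const_mul m).fun_mul hc).fun_mul hd).mul_const _).fun_div hDx hσ)).congr_deriv ?_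
    rw [← hD, eq_div_iff (pow_ne_zero 2 hσ), add_mul, div_mul_cancel₀ _ (pow_ne_zero 2 hσ)]
    generalize jacobiDen m σ = D at *
    clear hs hc hd hs' hc' hd' hE hE' HD hDx hDy Hs Hc Hd Hs' Hc' Hd'
    simp only [Nat.cast_ofNat, Nat.add_one_sub_one, pow_one]
    grind
  · refine (((((hs'.fun_pow 2).const_mul _).fun_div hDy hσ)).const_add _).congr_deriv ?_
    rw [← hD, ← neg_div, div_left_inj' (pow_ne_zero 2 hσ)]
    generalize jacobiDen m σ = D at *
    clear hs hc hd hs' hc' hd' hE hE' HD hDx hDy Hs Hc Hd Hs' Hc' Hd'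
    simp only [Nat.cast_ofNat, Nat.add_one_sub_one, pow_one]
    grind
  · refine ((((hd.fun_pow 2).const_mul _).fun_div hDx hσ).const_add _).congr_deriv ?_
    rw [← hD, div_left_inj' (pow_ne_zero 2 hσ)]
    generalize jacobiDen m σ = D at *
    clear hs hc hd hs' hc' hd' hE hE' HD hDx hDy Hs Hc Hd Hs' Hc' Hd'
    simp only [Nat.cast_ofNat, Nat.add_one_sub_one, pow_one]
    grind
  · refine ((((hasDerivAt_id' _).const_mul m).fun_sub hE').fun_add
      ((((hs'.fun_mul hc').fun_mul hd').mul_const _).fun_div hDy hσ)).congr_deriv ?_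
    rw [← hD, eq_div_iff (pow_ne_zero 2 hσ), add_mul, div_mul_cancel₀ _ (pow_ne_zero 2 hσ)]
    generalize jacobiDen m σ = D at *
    clear hs hc hd hs' hc' hd' hE hE' HD hDx hDy Hs Hc Hd Hs' Hc' Hd'
    simp only [Nat.cast_ofNat, Nat.add_one_sub_one, pow_one]
    grind

lemma jacobiDn_sq_eq {σ : ℂ} (hσ : jacobiDen m σ ≠ 0) :
    jacobiDn m σ ^ 2 = m * jacobiCn m σ ^ 2 + ((1 - m : ℝ) : ℂ) := by
  have e1 := realSn_sq_add_realCn_sq m σ.re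
  have e2 := realDn_sq hm σ.re
  have e3 := realSn_sq_add_realCn_sq (1 - m) σ.im
  have e4 := realDn_sq (one_sub_mem_Ioo hm) σ.im
  have hD : jacobiDen m σ =
    realCn (1 - m) σ.im ^ 2 + m * realSn m σ.re ^ 2 * realSn (1 - m) σ.im ^ 2 := rfl
  have hσ' : (jacobiDen m σ : ℂ) ≠ 0 := by exact_mod_cast hσ
  unfold jacobiDn jacobiCn
  rw [div_pow, div_pow, mul_div_assoc', div_add' _ _ _ (pow_ne_zero 2 hσ'),
    div_left_inj' (pow_ne_zero 2 hσ')]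
  generalize jacobiDen m σ = D at *
  apply Complex.ext
  · simp [sq]
    grind
  · simp [sq]
    grind

lemma jacobiDn_sq_add {σ : ℂ} (hσ : jacobiDen m σ ≠ 0) :
    jacobiDn m σ ^ 2 + ((√m : ℝ) * jacobiSn m σ) ^ 2 = 1 := by
  have e1 := realSn_sq_add_realCn_sq m σ.re
  have e2 := realDn_sq hm σ.re
  have e3 := realSn_sq_add_realCn_sq (1 - m) σ.im
  have e4 := realDn_sq (one_sub_mem_Ioo hm) σ.im
  have e5 : √m ^ 2 = m := Real.sq_sqrt hm.1.le
  have hD : jacobiDen m σ =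
    realCn (1 - m) σ.im ^ 2 + m * realSn m σ.re ^ 2 * realSn (1 - m) σ.im ^ 2 := rfl
  have hσ' : (jacobiDen m σ : ℂ) ≠ 0 := by exact_mod_cast hσ
  unfold jacobiDn jacobiSn
  rw [mul_div_assoc', div_pow, div_pow, ← add_div, div_eq_one_iff_eq (pow_ne_zero 2 hσ')]
  generalize jacobiDen m σ = D at *
  apply Complex.ext
  · simp [sq]
    grind
  · simp [sq]
    grind

lemma jacobiDen_eq_mul (σ : ℂ) : jacobiDen m σ =
    (realDn (1 - m) σ.im - √m * realCn m σ.re * realSn (1 - m) σ.im) * diskDen m σ := by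
  have e1 := realSn_sq_add_realCn_sq m σ.re
  have e3 := realSn_sq_add_realCn_sq (1 - m) σ.im
  have e4 := realDn_sq (one_sub_mem_Ioo hm) σ.im
  have e5 : √m ^ 2 = m := Real.sq_sqrt hm.1.le
  unfold jacobiDen diskDen
  grind

lemma diskCoord_eq {σ : ℂ} (hσ : jacobiDen m σ ≠ 0) :
    diskCoord m σ = jacobiDn m σ + Complex.I * ((√m : ℝ) * jacobiSn m σ) := by
  have e5 : √m ^ 2 = m := Real.sq_sqrt hm.1.le
  have hD := jacobiDen_eq_mul hm σ
  have hP : diskDen m σ ≠ 0 := fun h => hσ (by rw [hD, h, mul_zero])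
  have hP' : (diskDen m σ : ℂ) ≠ 0 := by exact_mod_cast hP
  have hσ' : (jacobiDen m σ : ℂ) ≠ 0 := by exact_mod_cast hσ
  unfold diskCoord jacobiDn jacobiSn
  rw [mul_div_assoc', mul_div_assoc', ← add_div, eq_div_iff hσ', hD]
  push_cast
  have h : ∀ a b : ℂ, a / diskDen m σ * (b * diskDen m σ) = a * b := fun a b => by field_simp
  rw [add_mul, mul_assoc Complex.I, h, h]
  apply Complex.ext
  · simp
    grind
  · simp
    grind

lemma normSq_diskCoord {σ : ℂ} (hσ : diskDen m σ ≠ 0) : Complex.normSq (diskCoord m σ) =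
    (realDn (1 - m) σ.im - √m * realCn m σ.re * realSn (1 - m) σ.im) / diskDen m σ := by
  have e1 := realSn_sq_add_realCn_sq m σ.re
  have e2 := realDn_sq hm σ.re
  have e3 := realSn_sq_add_realCn_sq (1 - m) σ.im
  have e4 := realDn_sq (one_sub_mem_Ioo hm) σ.im
  have e5 : √m ^ 2 = m := Real.sq_sqrt hm.1.le
  have hD : diskDen m σ =
    realDn (1 - m) σ.im + √m * realCn m σ.re * realSn (1 - m) σ.im := rfl
  unfold diskCoord
  rw [mul_comm Complex.I, Complex.normSq_add_mul_I, div_pow, div_pow, ← add_div,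
    div_eq_div_iff (pow_ne_zero 2 hσ) hσ]
  generalize diskDen m σ = D at *
  grind

/-- The common denominator of the Jacobi functions has no zero on the closed rectangle except at
`iK'`. -/
lemma jacobiDen_pos {σ : ℂ} (h1 : -completeK m ≤ σ.re) (h2 : σ.re ≤ completeK m)
    (h3 : 0 ≤ σ.im) (h4 : σ.im ≤ 2 * completeK (1 - m))
    (h5 : σ ≠ Complex.I * (completeK (1 - m) : ℂ)) : 0 < jacobiDen m σ := by
  have hm' := one_sub_mem_Ioo hm
  have hK := completeK_pos hm
  have e3 := realSn_sq_add_realCn_sq (1 - m) σ.im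
  by_cases hc : realCn (1 - m) σ.im = 0
  · have hre : σ.re ≠ 0 := by
      intro hre
      refine h5 (Complex.ext (by simpa using hre) ?_)
      have hnot : ¬ σ.im < completeK (1 - m) := fun h =>
        (realCn_pos hm' (by linarith [completeK_pos hm']) h).ne' hc
      have hnot' : ¬ completeK (1 - m) < σ.im := by
        intro h
        have := realCn_pos hm' (x := 2 * completeK (1 - m) - σ.im)
          (by linarith [completeK_pos hm']) (by linarith)
        rw [realCn_two_mul_completeK_sub hm', hc] at this
        simp at this
      simpa using le_antisymm (not_lt.1 hnot') (not_lt.1 hnot)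
    have hs : realSn m σ.re ≠ 0 := by
      rcases lt_or_gt_of_ne hre with h | h
      · have := realSn_pos hm (x := -σ.re) (by linarith) (by linarith)
        rw [realSn_neg hm] at this
        exact fun h => by simp [h] at this
      · exact (realSn_pos hm h (by linarith)).ne'
    have hs' : realSn (1 - m) σ.im ^ 2 = 1 := by
      rw [hc] at e3
      linarith
    unfold jacobiDen
    rw [hc, hs']
    have := pow_pos (abs_pos.2 hs) 2
    rw [sq_abs] at this
    have := mul_pos hm.1 this
    linarith
  · unfold jacobiDen
    have : 0 < realCn (1 - m) σ.im ^ 2 := by positivity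
    have h0 := hm.1
    positivity

lemma diskDen_pos {σ : ℂ} (h1 : -completeK m ≤ σ.re) (h2 : σ.re ≤ completeK m)
    (h3 : 0 ≤ σ.im) (h4 : σ.im ≤ 2 * completeK (1 - m)) : 0 < diskDen m σ := by
  have hm' := one_sub_mem_Ioo hm
  exact add_pos_of_pos_of_nonneg (realDn_pos hm' _)
    (mul_nonneg (mul_nonneg (Real.sqrt_nonneg _) (realCn_nonneg hm h1 h2))
      (realSn_nonneg hm' h3 h4))

lemma continuous_jacobiDen : Continuous (jacobiDen m) :=
  continuous_iff_continuousAt.2 fun σ => by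
    have hm' := one_sub_mem_Ioo hm
    have Hs := (differentiableAt_realSn_re hm σ).continuousAt
    have Hs' := (differentiableAt_realSn_im hm' σ).continuousAt
    have Hc' := (differentiableAt_realCn_im hm' σ).continuousAt
    unfold jacobiDen
    fun_prop

end

lemma segmentIntegral_eq_sub {f G : ℂ → ℂ} {Ω : Set ℂ} (hΩ : IsOpen Ω)
    (hG : ∀ z ∈ Ω, HasDerivAt G (f z) z) {p q : ℂ}
    (h : ∀ t ∈ Set.Icc (0 : ℝ) 1, p + (t : ℂ) * (q - p) ∈ Ω) :
    segmentIntegral f p q = G q - G p := by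
  have hγ : ∀ t : ℝ, HasDerivAt (fun t : ℝ => p + (t : ℂ) * (q - p)) (q - p) t := fun t => by
    simpa using ((hasDerivAt_id' t).ofReal_comp.mul_const (q - p)).const_add p
  have hd : DifferentiableOn ℂ G Ω := fun z hz => (hG z hz).differentiableAt.differentiableWithinAt
  have hf : ContinuousOn f Ω := (hd.deriv hΩ).continuousOn.congr fun z hz => (hG z hz).deriv.symm
  have hcont : ContinuousOn (fun t : ℝ => f (p + (t : ℂ) * (q - p)) * (q - p))
      (Set.uIcc (0 : ℝ) 1) := by
    rw [Set.uIcc_of_le zero_le_one]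
    exact (hf.comp (by fun_prop) h).mul continuousOn_const
  have := intervalIntegral.integral_eq_sub_of_hasDerivAt (a := 0) (b := 1)
    (f := fun t : ℝ => G (p + (t : ℂ) * (q - p)))
    (f' := fun t : ℝ => f (p + (t : ℂ) * (q - p)) * (q - p)) (fun t ht => ?_)
    hcont.intervalIntegrable
  · unfold segmentIntegral
    rw [this]
    simp
  · rw [Set.uIcc_of_le zero_le_one] at ht
    exact (hG _ (h t ht)).comp t (hγ t)

section

variable {m : ℝ} (hm : m ∈ Set.Ioo (0 : ℝ) 1)
include hm

lemma jacobiEps_zero : jacobiEps m 0 = 0 := by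
  have hm' := one_sub_mem_Ioo hm
  simp [jacobiEps, epsRe, epsIm, realE_zero hm, realE_zero hm', realSn_zero hm, realSn_zero hm']

lemma jacobiE_eq {σ : ℂ} (hσ : σ ∈ sigmaDomain m) :
    jacobiE m σ - ((1 - m : ℝ) : ℂ) * σ = jacobiEps m σ := by
  obtain ⟨h1, h2, h3, h4, h5⟩ := hσ
  have hm' := one_sub_mem_Ioo hm
  have hK := completeK_pos hm
  have hK' := completeK_pos hm'
  have hΩ : IsOpen {τ : ℂ | jacobiDen m τ ≠ 0} :=
    isOpen_ne.preimage (continuous_jacobiDen hm)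
  have hG : ∀ τ ∈ {τ : ℂ | jacobiDen m τ ≠ 0}, HasDerivAt
      (fun τ => jacobiEps m τ + ((1 - m : ℝ) : ℂ) * τ) (jacobiDn m τ ^ 2) τ := fun τ hτ => by
    rw [jacobiDn_sq_eq hm hτ]
    simpa using (hasDerivAt_jacobiEps hm hτ).fun_add
      ((hasDerivAt_id' τ).const_mul ((1 - m : ℝ) : ℂ))
  have key : ∀ s : ℝ, |s| = completeK m → 0 ≤ s * σ.re →
      segmentIntegral (fun v => jacobiDn m v ^ 2) 0 s +
        segmentIntegral (fun v => jacobiDn m v ^ 2) s σ =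
          jacobiEps m σ + ((1 - m : ℝ) : ℂ) * σ := by
    intro s hs hsσ
    rw [segmentIntegral_eq_sub hΩ hG, segmentIntegral_eq_sub hΩ hG, jacobiEps_zero hm]
    · ring
    · rintro t ⟨ht0, ht1⟩
      have hs1 : s = completeK m ∨ s = -completeK m := by
        rcases abs_choice s with h | h <;> rw [h] at hs
        · exact Or.inl hs
        · exact Or.inr (by linarith)
      refine (jacobiDen_pos hm ?_ ?_ ?_ ?_ ?_).ne' <;> simp
      · rcases hs1 with rfl | rfl <;> nlinarith
      · rcases hs1 with rfl | rfl <;> nlinarith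
      · positivity
      · nlinarith
      · intro h
        have hre := congrArg Complex.re h
        have him := congrArg Complex.im h
        simp at hre him
        have ht : t = 1 := by
          rcases hs1 with rfl | rfl
          · have : 0 ≤ σ.re := by
              by_contra! hneg
              nlinarith
            by_contra hne
            have : t < 1 := lt_of_le_of_ne ht1 hne
            nlinarith
          · have : σ.re ≤ 0 := by
              by_contra! hneg
              nlinarith
            by_contra hne
            have : t < 1 := lt_of_le_of_ne ht1 hne
            nlinarith
        subst ht
        refine h5 ?_
        rw [← h]
        simp
    · rintro t ⟨ht0, ht1⟩
      have hb := abs_le.1 hs.le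
      refine (jacobiDen_pos hm ?_ ?_ ?_ ?_ ?_).ne' <;> simp
      · nlinarith
      · nlinarith
      · exact hK'.le
      · intro h
        have him := congrArg Complex.im h
        simp at him
        exact hK'.ne him
  unfold jacobiE
  split_ifs with h0
  · rw [key (completeK m) (abs_of_pos hK) (by positivity)]
    ring
  · have := key (-completeK m) (by rw [abs_neg, abs_of_pos hK]) (by nlinarith)
    push_cast at this ⊢
    rw [this]
    ring

lemma norm_diskCoord_lt_one {σ : ℂ} (h1 : -completeK m < σ.re) (h2 : σ.re < completeK m)
    (h3 : 0 < σ.im) (h4 : σ.im < 2 * completeK (1 - m)) : ‖diskCoord m σ‖ < 1 := by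
  have hm' := one_sub_mem_Ioo hm
  have hP := diskDen_pos hm h1.le h2.le h3.le h4.le
  rw [← sq_lt_one_iff₀ (norm_nonneg _), ← Complex.normSq_eq_norm_sq, normSq_diskCoord hm hP.ne',
    div_lt_one hP]
  have : 0 < √m * realCn m σ.re * realSn (1 - m) σ.im :=
    mul_pos (mul_pos (Real.sqrt_pos.2 hm.1) (realCn_pos hm h1 h2)) (realSn_pos hm' h3 h4)
  unfold diskDen
  linarith

/-- The composition of `w(σ)` with the Möbius map is `dn - i √m sn`, the inverse of `diskCoord`. -/
lemma phi₃_wOfSigma {σ : ℂ} (hσ : σ ∈ sigmaDomain m) :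
    phi₃ (wOfSigma m σ) = (diskCoord m σ)⁻¹ := by
  obtain ⟨h1, h2, h3, h4, h5⟩ := hσ
  have hD := (jacobiDen_pos hm h1.le h2.le h3.le h4.le h5).ne'
  have hlt := norm_diskCoord_lt_one hm h1 h2 h3 h4
  have hU := diskCoord_eq hm hD
  have hone := jacobiDn_sq_add hm hD
  unfold phi₃ wOfSigma
  rw [hU] at hlt ⊢
  generalize (√m : ℝ) * jacobiSn m σ = v at *
  generalize jacobiDn m σ = e at *
  have hprod : (e + Complex.I * v) * (e - Complex.I * v) = 1 := by
    linear_combination hone + v ^ 2 * (-Complex.I_sq)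
  have hv : v ≠ 0 := by
    rintro rfl
    have : e ^ 2 = 1 := by simpa using hone
    have hn : ‖e‖ ^ 2 = 1 := by rw [← norm_pow, this, norm_one]
    rw [mul_zero, add_zero] at hlt
    nlinarith [norm_nonneg e]
  have hne : Complex.I * v - (1 - e) ≠ 0 := by
    intro h
    have : e + Complex.I * v = 1 := by linear_combination h
    rw [this, norm_one] at hlt
    exact lt_irrefl _ hlt
  rw [← eq_inv_of_mul_eq_one_right hprod, add_div' _ _ _ hv, sub_div' hv,
    div_div_div_cancel_right₀ hv, div_eq_iff hne]
  linear_combination -hone + v ^ 2 * Complex.I_sq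

end

/-! ### Proper and injective holomorphic maps -/

/-- A holomorphic local homeomorphism `f : S → T` into a connected set is onto if it is proper. The
last hypothesis is properness: `f` extends continuously to compact sets `C` which can be chosen such
that `f` stays away from a given point of `T` outside `C`, and the points of `C` that are not in `S`
are mapped to the complement of `T`. -/
lemma surjOn_of_isPreconnected {f f' : ℂ → ℂ} {S T : Set ℂ} (hS : IsOpen S) (hS' : S.Nonempty)
    (hf : ∀ z ∈ S, HasDerivAt f (f' z) z) (hf' : ∀ z ∈ S, f' z ≠ 0) (hT : IsPreconnected T)
    (hmaps : Set.MapsTo f S T)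
    (hproper : ∀ p ∈ T, ∃ C : Set ℂ, IsCompact C ∧ ContinuousOn f C ∧
      (∀ z ∈ C, f z ∈ T → z ∈ S) ∧ ∃ ε > 0, ∀ z ∈ S, z ∉ C → ε ≤ dist (f z) p) :
    Set.SurjOn f S T := by
  have hd : DifferentiableOn ℂ f S := fun z hz => (hf z hz).differentiableAt.differentiableWithinAt
  refine hT.subset_of_closure_inter_subset ?_ ?_ ?_
  · rw [isOpen_iff_mem_nhds]
    rintro _ ⟨z, hz, rfl⟩
    have hst := (hd.analyticAt (hS.mem_nhds hz)).hasStrictDerivAt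
    rw [(hf z hz).deriv] at hst
    rw [← hst.map_nhds_eq (hf' z hz)]
    exact Filter.image_mem_map (hS.mem_nhds hz)
  · obtain ⟨z, hz⟩ := hS'
    exact ⟨f z, hmaps hz, z, hz, rfl⟩
  · rintro p ⟨hp, hpT⟩
    obtain ⟨C, hC, hfC, hCS, ε, hε, hfar⟩ := hproper p hpT
    have hsub : f '' S ⊆ f '' C ∪ {q | ε ≤ dist q p} := by
      rintro _ ⟨z, hz, rfl⟩
      by_cases hzC : z ∈ C
      · exact Or.inl ⟨z, hzC, rfl⟩
      · exact Or.inr (hfar z hz hzC)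
    have hcl : IsClosed (f '' C ∪ {q | ε ≤ dist q p}) :=
      (hC.image_of_continuousOn hfC).isClosed.union
        (isClosed_le continuous_const (continuous_id.dist continuous_const))
    rcases closure_minimal hsub hcl hp with ⟨z, hz, rfl⟩ | h
    · exact ⟨z, hCS z hz hpT, rfl⟩
    · rw [Set.mem_ofPred_eq, dist_self] at h
      exact absurd hε (not_lt.2 h)

lemma hasDerivAt_of_leftInvOn {f f' g : ℂ → ℂ} {S : Set ℂ} (hS : IsOpen S)
    (hf : ∀ z ∈ S, HasDerivAt f (f' z) z) (hf' : ∀ z ∈ S, f' z ≠ 0) (hg : Set.LeftInvOn g f S)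
    {z : ℂ} (hz : z ∈ S) : HasDerivAt g (f' z)⁻¹ (f z) := by
  have hd : DifferentiableOn ℂ f S := fun z hz => (hf z hz).differentiableAt.differentiableWithinAt
  have hst := (hd.analyticAt (hS.mem_nhds hz)).hasStrictDerivAt
  rw [(hf z hz).deriv] at hst
  refine (hst.to_local_left_inverse (hf' z hz) ?_).hasDerivAt
  filter_upwards [hS.mem_nhds hz] with w hw using hg hw

/-! ### The map of the rectangle onto the unit disk -/

/-- The open rectangle `|Re σ| < K`, `0 < Im σ < 2K'`. -/
def sigmaRect (m : ℝ) : Set ℂ :=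
  {σ | -completeK m < σ.re ∧ σ.re < completeK m ∧ 0 < σ.im ∧ σ.im < 2 * completeK (1 - m)}

/-- The closed rectangle `|Re σ| ≤ K`, `0 ≤ Im σ ≤ 2K'`. -/
def sigmaClosedRect (m : ℝ) : Set ℂ :=
  Set.Icc (-completeK m) (completeK m) ×ℂ Set.Icc 0 (2 * completeK (1 - m))

lemma isOpen_sigmaRect (m : ℝ) : IsOpen (sigmaRect m) :=
  (isOpen_lt continuous_const Complex.continuous_re).inter
    ((isOpen_lt Complex.continuous_re continuous_const).inter
      ((isOpen_lt continuous_const Complex.continuous_im).inter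
        (isOpen_lt Complex.continuous_im continuous_const)))

lemma isCompact_sigmaClosedRect (m : ℝ) : IsCompact (sigmaClosedRect m) :=
  isCompact_Icc.reProdIm isCompact_Icc

lemma mem_sigmaDomain_iff {m : ℝ} {σ : ℂ} :
    σ ∈ sigmaDomain m ↔ σ ∈ sigmaRect m ∧ σ ≠ Complex.I * (completeK (1 - m) : ℂ) := by
  simp only [sigmaDomain, sigmaRect, Set.mem_ofPred_eq, and_assoc]

lemma sigmaRect_subset (m : ℝ) : sigmaRect m ⊆ sigmaClosedRect m :=
  fun _ ⟨h1, h2, h3, h4⟩ => ⟨⟨h1.le, h2.le⟩, h3.le, h4.le⟩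

/-- The distance of `y` from the nearer one of the ends of `[0, 2K]`. -/
noncomputable def foldK (m y : ℝ) : ℝ := completeK m - |y - completeK m|

section

variable {m : ℝ} (hm : m ∈ Set.Ioo (0 : ℝ) 1)
include hm

lemma I_mul_completeK_mem : Complex.I * (completeK (1 - m) : ℂ) ∈ sigmaRect m := by
  have h1 := completeK_pos hm
  have h2 := completeK_pos (one_sub_mem_Ioo hm)
  refine ⟨?_, ?_, ?_, ?_⟩ <;> simp [h1, h2]

lemma realSn_lt_realSn {x y : ℝ} (hx : -completeK m ≤ x) (hxy : x < y) (hy : y ≤ completeK m) :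
    realSn m x < realSn m y := by
  refine Real.sin_lt_sin_of_lt_of_le_pi_div_two ?_ ?_ (strictMono_jacobiAm hm hxy)
  · simpa only [jacobiAm_neg hm, jacobiAm_completeK hm] using
      (strictMono_jacobiAm hm).monotone hx
  · simpa only [jacobiAm_completeK hm] using (strictMono_jacobiAm hm).monotone hy

lemma realDn_lt_realDn {x y : ℝ} (hx : 0 ≤ x) (hxy : x < y) (hy : y ≤ completeK m) :
    realDn m y < realDn m x := by
  have hK := completeK_pos hm
  have hs := realSn_lt_realSn hm (by linarith) hxy hy
  have h0 := realSn_nonneg hm hx (by linarith)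
  have h1 := realDn_sq hm x
  have h2 := realDn_sq hm y
  have : realSn m x ^ 2 < realSn m y ^ 2 := by gcongr
  refine lt_of_pow_lt_pow_left₀ 2 (realDn_pos hm x).le ?_
  rw [h1, h2]
  have := mul_lt_mul_of_pos_left this hm.1
  linarith

lemma realSn_abs {x : ℝ} (h1 : -completeK m ≤ x) (h2 : x ≤ completeK m) :
    realSn m |x| = |realSn m x| := by
  rcases le_total 0 x with h | h
  · rw [abs_of_nonneg h, abs_of_nonneg (realSn_nonneg hm h (by linarith))]
  · have := realSn_nonneg hm (x := -x) (by linarith) (by linarith)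
    rw [abs_of_nonpos h, realSn_neg hm]
    rw [realSn_neg hm] at this
    rw [abs_of_nonpos (by linarith)]

lemma realCn_abs (x : ℝ) : realCn m |x| = realCn m x := by
  rcases abs_choice x with h | h <;> rw [h]
  exact realCn_neg hm x

lemma realDn_abs (x : ℝ) : realDn m |x| = realDn m x := by
  rcases abs_choice x with h | h <;> rw [h]
  exact realDn_neg hm x

omit hm in
lemma foldK_eq (m y : ℝ) : foldK m y = y ∨ foldK m y = 2 * completeK m - y := by
  unfold foldK
  rcases abs_choice (y - completeK m) with h | h <;> rw [h]
  · right; ring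
  · left; ring

omit hm in
lemma foldK_pos {y : ℝ} (h1 : 0 < y) (h2 : y < 2 * completeK m) : 0 < foldK m y := by
  rcases foldK_eq m y with h | h <;> rw [h] <;> linarith

omit hm in
lemma foldK_nonneg {y : ℝ} (h1 : 0 ≤ y) (h2 : y ≤ 2 * completeK m) : 0 ≤ foldK m y := by
  rcases foldK_eq m y with h | h <;> rw [h] <;> linarith

omit hm in
lemma foldK_le (m y : ℝ) : foldK m y ≤ completeK m := by
  unfold foldK
  linarith [abs_nonneg (y - completeK m)]

omit hm in
lemma foldK_eq_completeK {y : ℝ} (h : foldK m y = completeK m) : y = completeK m := by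
  unfold foldK at h
  have : y - completeK m = 0 := abs_eq_zero.1 (by linarith)
  linarith

lemma realSn_foldK (y : ℝ) : realSn m (foldK m y) = realSn m y := by
  rcases foldK_eq m y with h | h <;> rw [h]
  exact realSn_two_mul_completeK_sub hm y

lemma realDn_foldK (y : ℝ) : realDn m (foldK m y) = realDn m y := by
  rcases foldK_eq m y with h | h <;> rw [h]
  exact realDn_two_mul_completeK_sub hm y

lemma realCn_foldK {y : ℝ} (h1 : 0 ≤ y) (h2 : y ≤ 2 * completeK m) :
    realCn m (foldK m y) = |realCn m y| := by
  have hK := completeK_pos hm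
  have h3 := foldK_nonneg h1 h2
  have h0 := realCn_nonneg hm (by linarith) (foldK_le m y)
  rw [← abs_of_nonneg h0]
  rcases foldK_eq m y with h | h <;> rw [h]
  rw [realCn_two_mul_completeK_sub hm, abs_neg]

/-- The monotonicity behind the injectivity of `diskCoord` on a quarter of the rectangle: on a curve
where `cn(x) sn₁(y) / dn₁(y)` is constant, `y` increases with `x`, and so does the argument of
`diskCoord`. -/
lemma not_lt_of_quarter {x y x' y' : ℝ} (hx : 0 ≤ x) (hx' : x' < completeK m)
    (hy : 0 < y) (hyK : y ≤ completeK (1 - m)) (hy' : 0 < y') (hyK' : y' ≤ completeK (1 - m))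
    (h1 : realCn m x * realSn (1 - m) y * realDn (1 - m) y' =
      realCn m x' * realSn (1 - m) y' * realDn (1 - m) y)
    (h2 : realDn m x * realCn (1 - m) y * realSn m x' =
      realDn m x' * realCn (1 - m) y' * realSn m x) : ¬ x < x' := by
  intro hlt
  have hm' := one_sub_mem_Ioo hm
  have hK := completeK_pos hm
  have hK' := completeK_pos hm'
  have hc := realCn_lt_realCn hm hx hlt (by linarith)
  have hc0 := realCn_pos hm (x := x') (by linarith) hx'
  have hs := realSn_lt_realSn hm (by linarith) hlt hx'.le
  have hs0 := realSn_nonneg hm hx (by linarith)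
  have hd := realDn_lt_realDn hm hx hlt hx'.le
  have hd0 := realDn_pos hm x'
  have hs1 := realSn_pos hm' hy (by linarith)
  have hs1' := realSn_pos hm' hy' (by linarith)
  have hd1 := realDn_pos hm' y
  have hd1' := realDn_pos hm' y'
  have hyy : y < y' := by
    by_contra! hle
    have ha : realSn (1 - m) y' ≤ realSn (1 - m) y := by
      rcases hle.eq_or_lt with h | h
      · rw [h]
      · exact (realSn_lt_realSn hm' (by linarith) h hyK).le
    have hb : realDn (1 - m) y ≤ realDn (1 - m) y' := by
      rcases hle.eq_or_lt with h | h
      · rw [h]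
      · exact (realDn_lt_realDn hm' hy'.le h hyK).le
    have : realCn m x' * realSn (1 - m) y' * realDn (1 - m) y ≤
        realCn m x' * realSn (1 - m) y * realDn (1 - m) y' := by gcongr
    have : realCn m x' * realSn (1 - m) y * realDn (1 - m) y' <
        realCn m x * realSn (1 - m) y * realDn (1 - m) y' := by gcongr
    linarith
  have hc1 := realCn_lt_realCn hm' hy.le hyy (by linarith)
  have hc1' := realCn_nonneg hm' (by linarith) hyK'
  have hdx := realDn_pos hm x
  have ha : realDn m x' * realCn (1 - m) y' * realSn m x ≤
      realDn m x * realCn (1 - m) y' * realSn m x' := by gcongr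
  have hb : realDn m x * realCn (1 - m) y' * realSn m x' <
      realDn m x * realCn (1 - m) y * realSn m x' := by
    have : 0 < realSn m x' := by linarith
    gcongr
  linarith

lemma injOn_quarter {x y x' y' : ℝ} (hx : 0 ≤ x) (hxK : x < completeK m) (hx' : 0 ≤ x')
    (hxK' : x' < completeK m) (hy : 0 < y) (hyK : y ≤ completeK (1 - m)) (hy' : 0 < y')
    (hyK' : y' ≤ completeK (1 - m))
    (h1 : realCn m x * realSn (1 - m) y * realDn (1 - m) y' =
      realCn m x' * realSn (1 - m) y' * realDn (1 - m) y)
    (h2 : realDn m x * realCn (1 - m) y * realSn m x' =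
      realDn m x' * realCn (1 - m) y' * realSn m x) : x = x' ∧ y = y' := by
  have hm' := one_sub_mem_Ioo hm
  have hK' := completeK_pos hm'
  have hxx : x = x' := le_antisymm
    (not_lt.1 (not_lt_of_quarter hm hx' hxK hy' hyK' hy hyK h1.symm h2.symm))
    (not_lt.1 (not_lt_of_quarter hm hx hxK' hy hyK hy' hyK' h1 h2))
  subst hxx
  have hc := realCn_pos hm (x := x) (by linarith) hxK
  have key : ∀ {y y' : ℝ}, 0 < y → y' ≤ completeK (1 - m) →
      realCn m x * realSn (1 - m) y * realDn (1 - m) y' =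
        realCn m x * realSn (1 - m) y' * realDn (1 - m) y → ¬ y < y' := by
    intro y y' h0 hK h hlt
    have ha := realSn_lt_realSn hm' (by linarith) hlt hK
    have hb := realDn_lt_realDn hm' h0.le hlt hK
    have hc := realSn_pos hm' h0 (by linarith)
    have hd := realDn_pos hm' y'
    have : realCn m x * realSn (1 - m) y * realDn (1 - m) y' <
        realCn m x * realSn (1 - m) y' * realDn (1 - m) y := by gcongr
    linarith
  exact ⟨rfl, le_antisymm (not_lt.1 (key hy' hyK h1.symm)) (not_lt.1 (key hy hyK' h1))⟩

lemma injOn_diskCoord : Set.InjOn (diskCoord m) (sigmaRect m) := by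
  intro σ hσ τ hτ hστ
  have hm' := one_sub_mem_Ioo hm
  obtain ⟨a1, a2, a3, a4⟩ := hσ
  obtain ⟨b1, b2, b3, b4⟩ := hτ
  have hP := diskDen_pos hm a1.le a2.le a3.le a4.le
  have hP' := diskDen_pos hm b1.le b2.le b3.le b4.le
  have hn := congrArg Complex.normSq hστ
  rw [normSq_diskCoord hm hP.ne', normSq_diskCoord hm hP'.ne', div_eq_div_iff hP.ne' hP'.ne'] at hn
  have hre := congrArg Complex.re hστ
  have him := congrArg Complex.im hστ
  simp [diskCoord] at hre him
  have hk : 0 < √m := Real.sqrt_pos.2 hm.1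
  have h1 : realCn m σ.re * realSn (1 - m) σ.im * realDn (1 - m) τ.im =
      realCn m τ.re * realSn (1 - m) τ.im * realDn (1 - m) σ.im := by
    unfold diskDen at hn
    have : √m * (realCn m σ.re * realSn (1 - m) σ.im * realDn (1 - m) τ.im) =
      √m * (realCn m τ.re * realSn (1 - m) τ.im * realDn (1 - m) σ.im) := by
      linear_combination (-1 / 2) * hn
    exact mul_left_cancel₀ hk.ne' this
  generalize diskDen m σ = P at *
  generalize diskDen m τ = P' at *
  rw [div_eq_div_iff hP.ne' hP'.ne'] at hre him
  have him' : realSn m σ.re * P' = realSn m τ.re * P :=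
    mul_left_cancel₀ hk.ne' (by linear_combination him)
  -- `diskCoord` determines the signs of `sn(x)` and `cn₁(y)`, so folding loses no information.
  have h2 : realDn m σ.re * |realCn (1 - m) σ.im| * |realSn m τ.re| =
      realDn m τ.re * |realCn (1 - m) τ.im| * |realSn m σ.re| := by
    have e1 : realDn m σ.re * |realCn (1 - m) σ.im| * P' =
        realDn m τ.re * |realCn (1 - m) τ.im| * P := by
      have := congrArg abs hre
      simpa only [abs_mul, abs_of_pos hP, abs_of_pos hP', abs_of_pos (realDn_pos hm _)] using this
    have e2 : |realSn m σ.re| * P' = |realSn m τ.re| * P := by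
      have := congrArg abs him'
      simpa only [abs_mul, abs_of_pos hP, abs_of_pos hP'] using this
    refine mul_left_cancel₀ (mul_pos hP hP').ne' ?_
    linear_combination e1 * (|realSn m τ.re| * P) - e2 * (realDn m τ.re * |realCn (1 - m) τ.im| * P)
  have f1 := foldK_pos a3 a4
  have f2 := foldK_le (1 - m) σ.im
  have f3 := foldK_pos b3 b4
  have f4 := foldK_le (1 - m) τ.im
  obtain ⟨hx, hy⟩ := injOn_quarter hm (x := |σ.re|) (x' := |τ.re|) (abs_nonneg _)
    (abs_lt.2 ⟨a1, a2⟩) (abs_nonneg _) (abs_lt.2 ⟨b1, b2⟩) f1 f2 f3 f4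
    (by rw [realCn_abs hm, realCn_abs hm, realSn_foldK hm', realSn_foldK hm', realDn_foldK hm',
          realDn_foldK hm', h1])
    (by rw [realDn_abs hm, realDn_abs hm, realSn_abs hm a1.le a2.le, realSn_abs hm b1.le b2.le,
          realCn_foldK hm' a3.le a4.le, realCn_foldK hm' b3.le b4.le, h2])
  refine Complex.ext ?_ ?_
  · rcases abs_eq_abs.1 hx with h | h
    · exact h
    · have hs : realSn m τ.re * (P + P') = 0 := by
        rw [h, realSn_neg hm] at him'
        linear_combination -him'
      have hs' : realSn m |τ.re| = 0 := by
        rw [realSn_abs hm b1.le b2.le, (mul_eq_zero.1 hs).resolve_right (by positivity), abs_zero]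
      have hτ0 : |τ.re| = 0 := by
        by_contra hne
        have : 0 < |τ.re| := lt_of_le_of_ne (abs_nonneg _) (Ne.symm hne)
        have hlt : |τ.re| < completeK m := abs_lt.2 ⟨b1, b2⟩
        exact (realSn_pos hm this (by linarith)).ne' hs'
      rw [h, abs_eq_zero.1 hτ0, neg_zero]
  · have hab : |σ.im - completeK (1 - m)| = |τ.im - completeK (1 - m)| := by
      unfold foldK at hy
      linarith
    rcases abs_eq_abs.1 hab with h | h
    · linarith
    · have hc : realDn m τ.re * realCn (1 - m) τ.im * (P + P') = 0 := by
        have hd : realDn m σ.re = realDn m τ.re := by rw [← realDn_abs hm, hx, realDn_abs hm]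
        rw [show σ.im = 2 * completeK (1 - m) - τ.im by linarith,
          realCn_two_mul_completeK_sub hm', hd] at hre
        linear_combination -hre
      have hc' : realCn (1 - m) τ.im = 0 := by
        have h1 := (mul_eq_zero.1 hc).resolve_right (by positivity)
        exact (mul_eq_zero.1 h1).resolve_left (realDn_pos hm _).ne'
      have hfold : realCn (1 - m) (foldK (1 - m) τ.im) = 0 := by
        rw [realCn_foldK hm' b3.le b4.le, hc', abs_zero]
      have : foldK (1 - m) τ.im = completeK (1 - m) := by
        by_contra hne
        exact (realCn_pos hm' (by linarith) (lt_of_le_of_ne f4 hne)).ne' hfold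
      linarith [foldK_eq_completeK this]

lemma diskCoordDeriv_ne_zero {σ : ℂ} (hσ : σ ∈ sigmaRect m) : diskCoordDeriv m σ ≠ 0 := by
  obtain ⟨h1, h2, h3, h4⟩ := hσ
  have hm' := one_sub_mem_Ioo hm
  intro h
  have him := congrArg Complex.im h
  simp only [diskCoordDeriv, Complex.add_im, Complex.ofReal_im, Complex.I_mul_im,
    Complex.ofReal_re, Complex.zero_im, zero_add] at him
  have hk : 0 < √m := Real.sqrt_pos.2 hm.1
  have hc := realCn_pos hm h1 h2
  have hs := realSn_pos hm' h3 h4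
  have hd := realDn_pos hm σ.re
  have hd' := realDn_pos hm' σ.im
  have hP := diskDen_pos hm h1.le h2.le h3.le h4.le
  refine ne_of_gt ?_ him
  positivity

lemma bijOn_diskCoord : Set.BijOn (diskCoord m) (sigmaRect m) (Metric.ball 0 1) := by
  have hm' := one_sub_mem_Ioo hm
  have hmaps : Set.MapsTo (diskCoord m) (sigmaRect m) (Metric.ball 0 1) := by
    rintro σ ⟨h1, h2, h3, h4⟩
    simpa using norm_diskCoord_lt_one hm h1 h2 h3 h4
  have hder : ∀ σ ∈ sigmaClosedRect m, HasDerivAt (diskCoord m) (diskCoordDeriv m σ) σ := by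
    rintro σ ⟨⟨h1, h2⟩, h3, h4⟩
    exact hasDerivAt_diskCoord hm (diskDen_pos hm h1 h2 h3 h4).ne'
  refine ⟨hmaps, injOn_diskCoord hm, ?_⟩
  refine surjOn_of_isPreconnected (isOpen_sigmaRect m) ⟨_, I_mul_completeK_mem hm⟩
    (fun σ hσ => hder σ (sigmaRect_subset m hσ)) (fun σ hσ => diskCoordDeriv_ne_zero hm hσ)
    (convex_ball _ _).isPreconnected hmaps fun p hp =>
    ⟨sigmaClosedRect m, isCompact_sigmaClosedRect m,
      fun σ hσ => (hder σ hσ).continuousAt.continuousWithinAt, ?_,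
      1, one_pos, fun σ hσ h => absurd (sigmaRect_subset m hσ) h⟩
  rintro σ ⟨⟨h1, h2⟩, h3, h4⟩ hball
  -- On the boundary of the rectangle `cn(x) sn₁(y) = 0`, which makes `diskCoord` unimodular.
  have hP := diskDen_pos hm h1 h2 h3 h4
  have hne : realCn m σ.re * realSn (1 - m) σ.im ≠ 0 := by
    intro h
    have hn := normSq_diskCoord hm hP.ne'
    have e : diskDen m σ = realDn (1 - m) σ.im := by
      unfold diskDen
      linear_combination √m * h
    rw [show realDn (1 - m) σ.im - √m * realCn m σ.re * realSn (1 - m) σ.im = realDn (1 - m) σ.im by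
      linear_combination -√m * h, e, div_self (realDn_pos hm' _).ne', Complex.normSq_eq_norm_sq]
      at hn
    rw [mem_ball_zero_iff] at hball
    nlinarith [norm_nonneg (diskCoord m σ)]
  obtain ⟨hc, hs⟩ := mul_ne_zero_iff.1 hne
  refine ⟨lt_of_le_of_ne h1 fun h => hc ?_, lt_of_le_of_ne h2 fun h => hc ?_,
    lt_of_le_of_ne h3 fun h => hs ?_, lt_of_le_of_ne h4 fun h => hs ?_⟩
  · rw [← h, realCn_neg hm, realCn_completeK hm]
  · rw [h, realCn_completeK hm]
  · rw [← h, realSn_zero hm']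
  · rw [h, ← sub_zero (2 * completeK (1 - m)), realSn_two_mul_completeK_sub hm', realSn_zero hm']

end

/-! ### The map of the rectangle onto the exterior of a rectangle -/

/-- If `Re (c f') > 0` along the open segment from `p` to `q`, then the increment of `f` satisfies
the same inequality, relative to the direction of the segment. -/
lemma re_mul_sub_mul_conj_pos {f f' : ℂ → ℂ} {p q c : ℂ} (hpq : p ≠ q)
    (hf : ∀ t ∈ Set.Icc (0 : ℝ) 1,
      HasDerivAt f (f' (p + (t : ℂ) * (q - p))) (p + (t : ℂ) * (q - p)))
    (hf' : ∀ t ∈ Set.Ioo (0 : ℝ) 1, 0 < (c * f' (p + (t : ℂ) * (q - p))).re) :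
    0 < (c * (f q - f p) * (starRingEnd ℂ) (q - p)).re := by
  have hγ : ∀ t : ℝ, HasDerivAt (fun t : ℝ => p + (t : ℂ) * (q - p)) (q - p) t := fun t => by
    simpa using ((hasDerivAt_id' t).ofReal_comp.mul_const (q - p)).const_add p
  have hg : ∀ t ∈ Set.Icc (0 : ℝ) 1, HasDerivAt
      (fun t : ℝ => (c * f (p + (t : ℂ) * (q - p)) * (starRingEnd ℂ) (q - p)).re)
      ((c * f' (p + (t : ℂ) * (q - p))).re * Complex.normSq (q - p)) t := by
    intro t ht
    have h := (((hf t ht).comp t (hγ t)).const_mul c).mul_const ((starRingEnd ℂ) (q - p))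
    have h' := Complex.reCLM.hasFDerivAt.comp_hasDerivAt t h
    refine h'.congr_deriv ?_
    rw [← Complex.re_mul_ofReal, ← Complex.mul_conj]
    simp only [Complex.reCLM_apply, mul_assoc]
  have hmono : StrictMonoOn
      (fun t : ℝ => (c * f (p + (t : ℂ) * (q - p)) * (starRingEnd ℂ) (q - p)).re)
      (Set.Icc 0 1) := by
    refine strictMonoOn_of_deriv_pos (convex_Icc 0 1)
      (fun t ht => (hg t ht).continuousAt.continuousWithinAt) fun t ht => ?_
    rw [interior_Icc] at ht
    rw [(hg t (Set.Ioo_subset_Icc_self ht)).deriv]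
    exact mul_pos (hf' t ht) (Complex.normSq_pos.2 (sub_ne_zero.2 hpq.symm))
  have h := hmono (Set.left_mem_Icc.2 zero_le_one) (Set.right_mem_Icc.2 zero_le_one) zero_lt_one
  simp only [Complex.ofReal_zero, zero_mul, add_zero, Complex.ofReal_one, one_mul,
    add_sub_cancel] at h
  rw [mul_sub, sub_mul, Complex.sub_re]
  linarith

lemma isPreconnected_compl_reProdIm_Icc (a b c d : ℝ) :
    IsPreconnected {z : ℂ | ¬ (a ≤ z.re ∧ z.re ≤ b ∧ c ≤ z.im ∧ z.im ≤ d)} := by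
  have h1 : IsPreconnected {z : ℂ | z.re < a} := (convex_halfSpace_re_lt a).isPreconnected
  have h2 : IsPreconnected {z : ℂ | d < z.im} := (convex_halfSpace_im_gt d).isPreconnected
  have h3 : IsPreconnected {z : ℂ | b < z.re} := (convex_halfSpace_re_gt b).isPreconnected
  have h4 : IsPreconnected {z : ℂ | z.im < c} := (convex_halfSpace_im_lt c).isPreconnected
  have h12 := h1.union (⟨a - 1, d + 1⟩ : ℂ) (by simp) (by simp) h2
  have h123 := h12.union (⟨b + 1, d + 1⟩ : ℂ) (Or.inr (by simp)) (by simp) h3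
  have h1234 := h123.union (⟨b + 1, c - 1⟩ : ℂ) (Or.inr (by simp)) (by simp) h4
  convert h1234 using 1
  ext z
  simp only [Set.mem_ofPred_eq, Set.mem_union, not_and_or, not_le]
  tauto

section

variable {m : ℝ} (hm : m ∈ Set.Ioo (0 : ℝ) 1)
include hm

lemma epsRe_neg (x y : ℝ) : epsRe m (-x) y = -epsRe m x y := by
  simp only [epsRe, realE_neg hm, realSn_neg hm, realCn_neg hm, realDn_neg hm, neg_sq]
  ring

lemma epsIm_neg (x y : ℝ) : epsIm m (-x) y = epsIm m x y := by
  simp only [epsIm, realSn_neg hm, realDn_neg hm, neg_sq]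

lemma epsRe_two_mul_completeK_sub (x y : ℝ) :
    epsRe m x (2 * completeK (1 - m) - y) = epsRe m x y := by
  have hm' := one_sub_mem_Ioo hm
  simp only [epsRe, realSn_two_mul_completeK_sub hm', realCn_two_mul_completeK_sub hm', neg_sq]

lemma epsIm_two_mul_completeK_sub (x y : ℝ) :
    epsIm m x (2 * completeK (1 - m) - y) =
      -2 * (completeE (1 - m) - m * completeK (1 - m)) - epsIm m x y := by
  have hm' := one_sub_mem_Ioo hm
  simp only [epsIm, realSn_two_mul_completeK_sub hm', realCn_two_mul_completeK_sub hm', neg_sq,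
    realE_two_mul_completeK_sub hm', realDn_two_mul_completeK_sub hm']
  ring

/-- `E(x | m) - m₁ x`, a primitive of `m cn²`, is strictly increasing on `[-K, K]`. -/
lemma strictMonoOn_realE_sub :
    StrictMonoOn (fun x => realE m x - (1 - m) * x) (Set.Icc (-completeK m) (completeK m)) := by
  have hd : ∀ x, HasDerivAt (fun x => realE m x - (1 - m) * x) (m * realCn m x ^ 2) x := fun x => by
    refine ((hasDerivAt_realE hm x).fun_sub
      ((hasDerivAt_id' x).const_mul (1 - m))).congr_deriv ?_
    have := realSn_sq_add_realCn_sq m x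
    rw [realDn_sq hm]
    linear_combination (-m) * this
  refine strictMonoOn_of_deriv_pos (convex_Icc _ _)
    (fun x _ => (hd x).continuousAt.continuousWithinAt) fun x hx => ?_
  rw [interior_Icc] at hx
  rw [(hd x).deriv]
  have := realCn_pos hm hx.1 hx.2
  have := hm.1
  positivity

lemma realE_sub_pos {x : ℝ} (h0 : 0 < x) (h1 : x ≤ completeK m) :
    0 < realE m x - (1 - m) * x := by
  have hK := completeK_pos hm
  have h := strictMonoOn_realE_sub hm (a := 0) ⟨by linarith, by linarith⟩ ⟨by linarith, h1⟩ h0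
  simpa [realE_zero hm] using h

lemma completeE_sub_pos : 0 < completeE m - (1 - m) * completeK m := by
  simpa [realE_completeK hm] using realE_sub_pos hm (completeK_pos hm) le_rfl

lemma completeE_sub_pos' : 0 < completeE (1 - m) - m * completeK (1 - m) := by
  simpa using completeE_sub_pos (one_sub_mem_Ioo hm)

lemma epsRe_pos {x : ℝ} (y : ℝ) (h0 : 0 < x) (h1 : x < completeK m) : 0 < epsRe m x y := by
  have hK := completeK_pos hm
  have a := realE_sub_pos hm h0 h1.le
  have b := realSn_pos hm h0 (by linarith)
  have c := realCn_pos hm (x := x) (by linarith) h1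
  have d := realDn_pos hm x
  have e := hm.1
  unfold epsRe
  positivity

lemma epsRe_zero (y : ℝ) : epsRe m 0 y = 0 := by
  simp [epsRe, realE_zero hm, realSn_zero hm]

lemma epsIm_gt {y : ℝ} (x : ℝ) (h0 : 0 < y) (h1 : y < completeK (1 - m)) :
    -(completeE (1 - m) - m * completeK (1 - m)) < epsIm m x y := by
  have hm' := one_sub_mem_Ioo hm
  have hK := completeK_pos hm'
  have a := strictMonoOn_realE_sub hm' (a := y) (b := completeK (1 - m)) ⟨by linarith, h1.le⟩
    ⟨by linarith, le_rfl⟩ h1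
  simp only [realE_completeK hm', sub_sub_cancel] at a
  have b := realSn_pos hm' h0 (by linarith)
  have c := realCn_pos hm' (x := y) (by linarith) h1
  have d := realDn_pos hm x
  have e := hm.1
  have f := realDn_pos hm' y
  have : 0 < realSn (1 - m) y * realCn (1 - m) y * realDn (1 - m) y * realDn m x ^ 2 /
      (realCn (1 - m) y ^ 2 + m * realSn m x ^ 2 * realSn (1 - m) y ^ 2) := by positivity
  unfold epsIm
  linarith

lemma epsIm_completeK (x : ℝ) :
    epsIm m x (completeK (1 - m)) = -(completeE (1 - m) - m * completeK (1 - m)) := by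
  have hm' := one_sub_mem_Ioo hm
  simp [epsIm, realE_completeK hm', realCn_completeK hm']

lemma abs_epsRe {x : ℝ} (y : ℝ) (h1 : -completeK m < x) (h2 : x < completeK m) :
    |epsRe m x y| = epsRe m |x| (foldK (1 - m) y) := by
  have e : epsRe m |x| (foldK (1 - m) y) = epsRe m |x| y := by
    rcases foldK_eq (1 - m) y with h | h <;> rw [h]
    exact epsRe_two_mul_completeK_sub hm _ _
  rw [e]
  rcases lt_trichotomy x 0 with h | h | h
  · have := epsRe_pos hm y (x := -x) (by linarith) (by linarith)
    rw [abs_of_neg h, epsRe_neg hm] at *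
    rw [abs_of_neg (by linarith)]
  · simp [h, epsRe_zero hm]
  · rw [abs_of_pos h, abs_of_pos (epsRe_pos hm y h h2)]

lemma abs_epsIm_add {y : ℝ} (x : ℝ) (h1 : 0 < y) (h2 : y < 2 * completeK (1 - m)) :
    |epsIm m x y + (completeE (1 - m) - m * completeK (1 - m))| =
      epsIm m |x| (foldK (1 - m) y) + (completeE (1 - m) - m * completeK (1 - m)) := by
  have e : epsIm m |x| (foldK (1 - m) y) = epsIm m x (foldK (1 - m) y) := by
    rcases abs_choice x with h | h <;> rw [h]
    exact epsIm_neg hm _ _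
  rw [e]
  have h0 : 0 ≤ epsIm m x (foldK (1 - m) y) + (completeE (1 - m) - m * completeK (1 - m)) := by
    rcases (foldK_le (1 - m) y).eq_or_lt with h | h
    · rw [h, epsIm_completeK hm, neg_add_cancel]
    · linarith [epsIm_gt hm x (foldK_pos h1 h2) h]
  rcases foldK_eq (1 - m) y with h | h <;> rw [h] at h0 ⊢
  · exact abs_of_nonneg h0
  · rw [epsIm_two_mul_completeK_sub hm] at h0 ⊢
    rw [abs_of_nonpos (by linarith)]
    ring

omit hm in
lemma jacobiEps_re (m : ℝ) (σ : ℂ) : (jacobiEps m σ).re = epsRe m σ.re σ.im := by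
  simp [jacobiEps]

omit hm in
lemma jacobiEps_im (m : ℝ) (σ : ℂ) : (jacobiEps m σ).im = epsIm m σ.re σ.im := by
  simp [jacobiEps]

omit hm in
lemma mul_jacobiCn_sq_re (m : ℝ) (σ : ℂ) : ((m : ℂ) * jacobiCn m σ ^ 2).re =
    m * ((realCn m σ.re * realCn (1 - m) σ.im) ^ 2 -
        (realSn m σ.re * realDn m σ.re * realSn (1 - m) σ.im * realDn (1 - m) σ.im) ^ 2) /
          jacobiDen m σ ^ 2 := by
  rw [mul_jacobiCn_sq, Complex.add_re, Complex.ofReal_re, Complex.I_mul_re, Complex.ofReal_im,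
    neg_zero, add_zero]

omit hm in
lemma mul_jacobiCn_sq_im (m : ℝ) (σ : ℂ) : ((m : ℂ) * jacobiCn m σ ^ 2).im =
    -(2 * m * (realCn m σ.re * realCn (1 - m) σ.im) *
        (realSn m σ.re * realDn m σ.re * realSn (1 - m) σ.im * realDn (1 - m) σ.im)) /
          jacobiDen m σ ^ 2 := by
  rw [mul_jacobiCn_sq, Complex.add_im, Complex.ofReal_im, Complex.I_mul_im, Complex.ofReal_re,
    zero_add]

/-- On the quarter `0 < x < K`, `0 < y < K'` of the rectangle `cn` lies in the fourth quadrant. -/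
lemma mul_jacobiCn_sq_im_neg {σ : ℂ} (h1 : 0 < σ.re) (h2 : σ.re < completeK m) (h3 : 0 < σ.im)
    (h4 : σ.im < completeK (1 - m)) : 0 < (Complex.I * ((m : ℂ) * jacobiCn m σ ^ 2)).re := by
  have hm' := one_sub_mem_Ioo hm
  have hD : 0 < jacobiDen m σ := by
    refine jacobiDen_pos hm ?_ h2.le h3.le ?_ fun h => ?_
    · linarith [completeK_pos hm]
    · linarith
    · rw [h] at h1
      simp at h1
  rw [Complex.I_mul_re, mul_jacobiCn_sq_im, ← neg_div, neg_neg]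
  have := hm.1
  have := realCn_pos hm (x := σ.re) (by linarith) h2
  have := realCn_pos hm' (x := σ.im) (by linarith) h4
  have := realSn_pos hm (x := σ.re) (by linarith) (by linarith)
  have := realSn_pos hm' (x := σ.im) (by linarith) (by linarith)
  have := realDn_pos hm σ.re
  have := realDn_pos hm' σ.im
  positivity

/-- No point of the quarter `0 ≤ x < K`, `0 < y ≤ K'` is mapped to the quadrant below and to the
left of the image of the corner `K`: from `K` the point is seen in direction `(-, +)` and its image
would be seen in direction `(-, -)`, which `re_mul_sub_mul_conj_pos` excludes. -/
lemma not_eps_le {σ : ℂ} (h1 : 0 ≤ σ.re) (h2 : σ.re < completeK m) (h3 : 0 < σ.im)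
    (h4 : σ.im ≤ completeK (1 - m)) (h5 : σ ≠ Complex.I * (completeK (1 - m) : ℂ)) :
    ¬ (epsRe m σ.re σ.im ≤ completeE m - (1 - m) * completeK m ∧ epsIm m σ.re σ.im ≤ 0) := by
  rintro ⟨ha, hb⟩
  have hm' := one_sub_mem_Ioo hm
  have hK := completeK_pos hm
  have hK' := completeK_pos hm'
  have h := re_mul_sub_mul_conj_pos (f := jacobiEps m) (f' := fun σ => m * jacobiCn m σ ^ 2)
    (p := completeK m) (q := σ) (c := Complex.I) ?_ ?_ ?_
  · have e1 : epsRe m (completeK m) 0 = completeE m - (1 - m) * completeK m := by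
      simp [epsRe, realE_completeK hm, realCn_completeK hm]
    have e2 : epsIm m (completeK m) 0 = 0 := by
      simp [epsIm, realE_zero hm', realSn_zero hm']
    simp [jacobiEps_re, jacobiEps_im, e1, e2] at h
    nlinarith
  · rintro rfl
    simp at h3
  · rintro t ⟨ht0, ht1⟩
    refine hasDerivAt_jacobiEps hm (jacobiDen_pos hm ?_ ?_ ?_ ?_ fun h => ?_).ne'
    · simp; nlinarith
    · simp; nlinarith
    · simp; positivity
    · simp; nlinarith
    · have hre := congrArg Complex.re h
      simp at hre
      have ht : t = 1 := by
        by_contra hne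
        have : t < 1 := lt_of_le_of_ne ht1 hne
        nlinarith
      subst ht
      exact h5 (by rw [← h]; simp)
  · rintro t ⟨ht0, ht1⟩
    refine mul_jacobiCn_sq_im_neg hm ?_ ?_ ?_ ?_ <;> simp <;> nlinarith

lemma injOn_jacobiEps_quarter {σ τ : ℂ} (h1 : 0 ≤ σ.re) (h2 : σ.re < completeK m) (h3 : 0 < σ.im)
    (h4 : σ.im ≤ completeK (1 - m)) (h5 : σ ≠ Complex.I * (completeK (1 - m) : ℂ))
    (h1' : 0 ≤ τ.re) (h2' : τ.re < completeK m) (h3' : 0 < τ.im)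
    (h4' : τ.im ≤ completeK (1 - m)) (h5' : τ ≠ Complex.I * (completeK (1 - m) : ℂ))
    (h : jacobiEps m σ = jacobiEps m τ) : σ = τ := by
  by_contra hne
  have hm' := one_sub_mem_Ioo hm
  have hK := completeK_pos hm
  have hK' := completeK_pos hm'
  have hre : ∀ t : ℝ, (σ + (t : ℂ) * (τ - σ)).re = (1 - t) * σ.re + t * τ.re := fun t => by
    simp; ring
  have him : ∀ t : ℝ, (σ + (t : ℂ) * (τ - σ)).im = (1 - t) * σ.im + t * τ.im := fun t => by
    simp; ring
  have hD : ∀ t ∈ Set.Icc (0 : ℝ) 1, 0 < jacobiDen m (σ + (t : ℂ) * (τ - σ)) := by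
    rintro t ⟨ht0, ht1⟩
    -- `iK'` is an extreme point of the quarter rectangle.
    refine jacobiDen_pos hm ?_ ?_ ?_ ?_ fun hh => ?_
    · rw [hre]; nlinarith
    · rw [hre]; nlinarith
    · rw [him]; nlinarith
    · rw [him]; nlinarith
    · have e1 := congrArg Complex.re hh
      have e2 := congrArg Complex.im hh
      rw [hre] at e1
      rw [him] at e2
      simp at e1 e2
      rcases ht0.eq_or_lt with rfl | ht0
      · exact h5 (by rw [← hh]; simp)
      rcases ht1.eq_or_lt with rfl | ht1
      · exact h5' (by rw [← hh]; simp)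
      have ht1' : 0 < 1 - t := by linarith
      have a1 : 0 ≤ (1 - t) * σ.re := by positivity
      have a2 : 0 ≤ t * τ.re := by positivity
      have b1 : (1 - t) * σ.re = 0 := by linarith
      have a3 : (1 - t) * σ.im ≤ (1 - t) * completeK (1 - m) := by gcongr
      have a4 : t * τ.im ≤ t * completeK (1 - m) := by gcongr
      have b2 : (1 - t) * σ.im = (1 - t) * completeK (1 - m) := by linarith
      refine h5 (Complex.ext ?_ ?_)
      · simpa using (mul_eq_zero.1 b1).resolve_left ht1'.ne'
      · simpa using mul_left_cancel₀ ht1'.ne' b2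
  have key : ∀ c : ℂ, ¬ ∀ t ∈ Set.Ioo (0 : ℝ) 1,
      0 < (c * (m * jacobiCn m (σ + (t : ℂ) * (τ - σ)) ^ 2)).re := by
    intro c hc
    have := re_mul_sub_mul_conj_pos (f := jacobiEps m) (f' := fun σ => m * jacobiCn m σ ^ 2) hne
      (fun t ht => hasDerivAt_jacobiEps hm (hD t ht).ne') hc
    rw [h, sub_self, mul_zero, zero_mul] at this
    exact lt_irrefl _ this
  by_cases hx : σ.re = 0 ∧ τ.re = 0
  · -- On the imaginary axis `cn` is real.
    refine key 1 fun t ht => ?_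
    have hx0 : (σ + (t : ℂ) * (τ - σ)).re = 0 := by rw [hre, hx.1, hx.2]; ring
    have hy : (σ + (t : ℂ) * (τ - σ)).im < completeK (1 - m) := by
      have a1 : σ.im < completeK (1 - m) := lt_of_le_of_ne h4 fun e =>
        h5 (Complex.ext (by simpa using hx.1) (by simpa using e))
      rw [him]; nlinarith [ht.1, ht.2]
    have hy' : 0 < (σ + (t : ℂ) * (τ - σ)).im := by rw [him]; nlinarith [ht.1, ht.2]
    have := realCn_pos hm' (by linarith) hy
    have := hD t (Set.Ioo_subset_Icc_self ht)
    have := hm.1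
    rw [one_mul, mul_jacobiCn_sq_re, hx0, realSn_zero hm, realCn_zero hm]
    simp only [one_mul, zero_mul, ne_eq, OfNat.ofNat_ne_zero, not_false_eq_true, zero_pow, sub_zero]
    positivity
  by_cases hy : σ.im = completeK (1 - m) ∧ τ.im = completeK (1 - m)
  · -- On the line `Im σ = K'` `cn` is imaginary.
    refine key (-1) fun t ht => ?_
    have hy0 : (σ + (t : ℂ) * (τ - σ)).im = completeK (1 - m) := by rw [him, hy.1, hy.2]; ring
    have a1 : 0 < σ.re := lt_of_le_of_ne h1 fun e =>
        h5 (Complex.ext (by simpa using e.symm) (by simpa using hy.1))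
    have hx1 : 0 < (σ + (t : ℂ) * (τ - σ)).re := by rw [hre]; nlinarith [ht.1, ht.2]
    have hx2 : (σ + (t : ℂ) * (τ - σ)).re < completeK m := by rw [hre]; nlinarith [ht.1, ht.2]
    have := realSn_pos hm hx1 (by linarith)
    have := hD t (Set.Ioo_subset_Icc_self ht)
    have := hm.1
    have := realDn_pos hm (σ + (t : ℂ) * (τ - σ)).re
    have := realDn_pos hm' (completeK (1 - m))
    rw [neg_one_mul, Complex.neg_re, mul_jacobiCn_sq_re, hy0, realCn_completeK hm',
      realSn_completeK hm', ← neg_div, neg_mul_eq_mul_neg, neg_sub, mul_zero, zero_pow two_ne_zero,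
      sub_zero]
    positivity
  · refine key Complex.I fun t ⟨ht0, ht1⟩ => ?_
    have ht1' : 0 < 1 - t := by linarith
    refine mul_jacobiCn_sq_im_neg hm ?_ ?_ ?_ ?_
    · rw [hre]
      rcases h1.eq_or_lt with e | e
      · have : 0 < τ.re := lt_of_le_of_ne h1' fun e' => hx ⟨e.symm, e'.symm⟩
        positivity
      · positivity
    · rw [hre]; nlinarith
    · rw [him]; nlinarith
    · rw [him]
      rcases h4.eq_or_lt with e | e
      · have : τ.im < completeK (1 - m) := lt_of_le_of_ne h4' fun e' => hy ⟨e, e'⟩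
        nlinarith
      · nlinarith

end

/-- The exterior of the rectangle `|Re w| ≤ E - m₁ K`, `-2 (E' - m K') ≤ Im w ≤ 0`. -/
def epsExterior (m : ℝ) : Set ℂ :=
  {w | ¬ (-(completeE m - (1 - m) * completeK m) ≤ w.re ∧
    w.re ≤ completeE m - (1 - m) * completeK m ∧
    -2 * (completeE (1 - m) - m * completeK (1 - m)) ≤ w.im ∧ w.im ≤ 0)}

section

variable {m : ℝ} (hm : m ∈ Set.Ioo (0 : ℝ) 1)
include hm

lemma jacobiEps_mem_epsExterior_iff {σ : ℂ} (h1 : -completeK m < σ.re) (h2 : σ.re < completeK m)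
    (h3 : 0 < σ.im) (h4 : σ.im < 2 * completeK (1 - m)) :
    jacobiEps m σ ∈ epsExterior m ↔
      ¬ (epsRe m |σ.re| (foldK (1 - m) σ.im) ≤ completeE m - (1 - m) * completeK m ∧
        epsIm m |σ.re| (foldK (1 - m) σ.im) ≤ 0) := by
  have e : epsIm m |σ.re| (foldK (1 - m) σ.im) ≤ 0 ↔
      epsIm m |σ.re| (foldK (1 - m) σ.im) + (completeE (1 - m) - m * completeK (1 - m)) ≤
        completeE (1 - m) - m * completeK (1 - m) := by
    constructor <;> intro h <;> linarith
  rw [e, ← abs_epsRe hm _ h1 h2, ← abs_epsIm_add hm _ h3 h4, abs_le, abs_le]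
  simp only [epsExterior, Set.mem_ofPred_eq, jacobiEps_re, jacobiEps_im, and_assoc]
  refine not_congr (and_congr_right fun _ => and_congr_right fun _ => ?_)
  constructor <;> rintro ⟨ha, hb⟩ <;> constructor <;> linarith

omit hm in
lemma fold_ne {σ : ℂ} (h : σ ≠ Complex.I * (completeK (1 - m) : ℂ)) :
    (⟨|σ.re|, foldK (1 - m) σ.im⟩ : ℂ) ≠ Complex.I * (completeK (1 - m) : ℂ) := by
  intro h'
  have hre := congrArg Complex.re h'
  have him := congrArg Complex.im h'
  simp at hre him
  exact h (Complex.ext (by simpa using hre) (by simpa using foldK_eq_completeK him))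

lemma mapsTo_jacobiEps : Set.MapsTo (jacobiEps m) (sigmaDomain m) (epsExterior m) := by
  rintro σ ⟨h1, h2, h3, h4, h5⟩
  rw [jacobiEps_mem_epsExterior_iff hm h1 h2 h3 h4]
  exact not_eps_le hm (σ := ⟨|σ.re|, foldK (1 - m) σ.im⟩) (abs_nonneg _) (abs_lt.2 ⟨h1, h2⟩)
    (foldK_pos h3 h4) (foldK_le _ _) (fold_ne h5)

lemma eq_zero_of_epsRe_eq_zero {x y : ℝ} (h1 : -completeK m < x) (h2 : x < completeK m)
    (h : epsRe m x y = 0) : x = 0 := by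
  have h0 := abs_epsRe hm y h1 h2
  rw [h, abs_zero] at h0
  by_contra hne
  exact (epsRe_pos hm _ (abs_pos.2 hne) (abs_lt.2 ⟨h1, h2⟩)).ne h0

lemma eq_completeK_of_epsIm_eq {x y : ℝ} (h1 : 0 < y) (h2 : y < 2 * completeK (1 - m))
    (h : epsIm m x y = -(completeE (1 - m) - m * completeK (1 - m))) :
    y = completeK (1 - m) := by
  have h0 := abs_epsIm_add hm x h1 h2
  rw [h, neg_add_cancel, abs_zero] at h0
  by_contra hne
  have := epsIm_gt hm |x| (foldK_pos h1 h2)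
    (lt_of_le_of_ne (foldK_le _ _) fun h => hne (foldK_eq_completeK h))
  linarith

lemma injOn_jacobiEps : Set.InjOn (jacobiEps m) (sigmaDomain m) := by
  rintro σ ⟨h1, h2, h3, h4, h5⟩ τ ⟨h1', h2', h3', h4', h5'⟩ h
  have hre : epsRe m σ.re σ.im = epsRe m τ.re τ.im := by
    simpa [jacobiEps_re] using congrArg Complex.re h
  have him : epsIm m σ.re σ.im = epsIm m τ.re τ.im := by
    simpa [jacobiEps_im] using congrArg Complex.im h
  have hfold : (⟨|σ.re|, foldK (1 - m) σ.im⟩ : ℂ) = ⟨|τ.re|, foldK (1 - m) τ.im⟩ := by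
    refine injOn_jacobiEps_quarter hm (abs_nonneg _) (abs_lt.2 ⟨h1, h2⟩) (foldK_pos h3 h4)
      (foldK_le _ _) (fold_ne h5) (abs_nonneg _) (abs_lt.2 ⟨h1', h2'⟩) (foldK_pos h3' h4')
      (foldK_le _ _) (fold_ne h5') (Complex.ext ?_ ?_)
    · simp only [jacobiEps_re]
      rw [← abs_epsRe hm _ h1 h2, ← abs_epsRe hm _ h1' h2', hre]
    · simp only [jacobiEps_im]
      have e1 := abs_epsIm_add hm σ.re h3 h4
      have e2 := abs_epsIm_add hm τ.re h3' h4'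
      rw [him, e2] at e1
      linarith
  have hx : |σ.re| = |τ.re| := congrArg Complex.re hfold
  have hy : |σ.im - completeK (1 - m)| = |τ.im - completeK (1 - m)| := by
    have : foldK (1 - m) σ.im = foldK (1 - m) τ.im := congrArg Complex.im hfold
    unfold foldK at this
    linarith
  have hre' : epsRe m σ.re τ.im = epsRe m σ.re σ.im := by
    rcases abs_eq_abs.1 hy with e | e
    · rw [sub_left_injective e]
    · rw [show τ.im = 2 * completeK (1 - m) - σ.im by linarith, epsRe_two_mul_completeK_sub hm]
  have him' : epsIm m τ.re σ.im = epsIm m σ.re σ.im := by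
    rcases abs_eq_abs.1 hx with e | e <;> rw [e]
    exact (epsIm_neg hm _ _).symm
  refine Complex.ext ?_ ?_
  · rcases abs_eq_abs.1 hx with e | e
    · exact e
    · have hτ : τ.re = 0 := by
        refine eq_zero_of_epsRe_eq_zero hm h1' h2' (y := τ.im) ?_
        rw [← hre', e, epsRe_neg hm] at hre
        linarith
      rw [e, hτ, neg_zero]
  · rcases abs_eq_abs.1 hy with e | e
    · exact sub_left_injective e
    · have hσ : σ.im = completeK (1 - m) := by
        refine eq_completeK_of_epsIm_eq hm h3 h4 (x := σ.re) ?_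
        rw [show τ.im = 2 * completeK (1 - m) - σ.im by linarith,
          epsIm_two_mul_completeK_sub hm, him'] at him
        linarith
      linarith

/-- `E(σ | m) - m₁ σ` has a pole at `iK'`. -/
lemma eventually_le_norm_jacobiEps (M : ℝ) :
    ∀ᶠ σ in nhds (Complex.I * (completeK (1 - m) : ℂ)), 0 < jacobiDen m σ →
      M ≤ ‖jacobiEps m σ‖ := by
  have hm' := one_sub_mem_Ioo hm
  set P : ℂ := Complex.I * (completeK (1 - m) : ℂ) with hPdef
  have hPre : P.re = 0 := by simp [hPdef]
  have hPim : P.im = completeK (1 - m) := by simp [hPdef]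
  have Hs := (differentiableAt_realSn_re hm P).continuousAt
  have Hc := (differentiableAt_realCn_re hm P).continuousAt
  have Hd := (differentiableAt_realDn_re hm P).continuousAt
  have HE := (differentiableAt_realE_re hm P).continuousAt
  have Hs' := (differentiableAt_realSn_im hm' P).continuousAt
  have Hc' := (differentiableAt_realCn_im hm' P).continuousAt
  have Hd' := (differentiableAt_realDn_im hm' P).continuousAt
  have HE' := (differentiableAt_realE_im hm' P).continuousAt
  have hk0 := hm.1
  have hd1 : m < realDn (1 - m) (completeK (1 - m)) := by
    have h1 := realDn_sq hm' (completeK (1 - m))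
    rw [realSn_completeK hm'] at h1
    have h2 := realDn_pos hm' (completeK (1 - m))
    nlinarith [hm.2]
  -- The summands without a pole are bounded near `iK'`.
  obtain ⟨G, hG⟩ : ∃ G, G = |realE m P.re - (1 - m) * P.re| + |m * P.im - realE (1 - m) P.im| + 1 :=
    ⟨_, rfl⟩
  have cg : ContinuousAt (fun σ : ℂ => |realE m σ.re - (1 - m) * σ.re| +
      |m * σ.im - realE (1 - m) σ.im|) P := by
    have h1 : ContinuousAt (fun σ : ℂ => realE m σ.re - (1 - m) * σ.re) P :=
      HE.sub (Complex.continuous_re.continuousAt.const_mul _)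
    have h2 : ContinuousAt (fun σ : ℂ => m * σ.im - realE (1 - m) σ.im) P :=
      (Complex.continuous_im.continuousAt.const_mul _).sub HE'
    exact h1.abs.add h2.abs
  have ev1 := cg.eventually_lt_const (show _ < G by rw [hG]; linarith)
  -- The cofactors of the vanishing factors `sn(x)` and `cn₁(y)` stay away from `0`.
  have c2 : ContinuousAt (fun σ : ℂ => m * realCn m σ.re * realDn m σ.re *
      realSn (1 - m) σ.im ^ 2) P := ((Hc.const_mul m).mul Hd).mul (Hs'.pow 2)
  have ev2 := c2.eventually_const_lt (show m / 2 < _ by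
    dsimp only
    rw [hPre, hPim, realCn_zero hm, realDn_zero hm, realSn_completeK hm']
    linarith)
  have c3 : ContinuousAt (fun σ : ℂ => realSn (1 - m) σ.im * realDn (1 - m) σ.im *
      realDn m σ.re ^ 2) P := (Hs'.mul Hd').mul (Hd.pow 2)
  have ev3 := c3.eventually_const_lt (show m / 2 < _ by
    dsimp only
    rw [hPre, hPim, realDn_zero hm, realSn_completeK hm']
    linarith)
  obtain ⟨δ, hδ⟩ : ∃ δ, δ = m / 2 / (2 * |M| + |G| + 1) := ⟨_, rfl⟩
  have hδ0 : 0 < δ := by rw [hδ]; positivity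
  have c4 : ContinuousAt (fun σ : ℂ => |realSn m σ.re| + |realCn (1 - m) σ.im|) P :=
    Hs.abs.add Hc'.abs
  have ev4 := c4.eventually_lt_const (show _ < δ by
    dsimp only
    rw [hPre, hPim, realSn_zero hm, realCn_completeK hm', abs_zero, add_zero]
    exact hδ0)
  filter_upwards [ev1, ev2, ev3, ev4] with σ g1 g2 g3 g4 hD
  have e1 : epsRe m σ.re σ.im = (realE m σ.re - (1 - m) * σ.re) +
      realSn m σ.re * (m * realCn m σ.re * realDn m σ.re * realSn (1 - m) σ.im ^ 2) /
        jacobiDen m σ := by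
    unfold epsRe jacobiDen
    ring
  have e2 : epsIm m σ.re σ.im = (m * σ.im - realE (1 - m) σ.im) +
      realCn (1 - m) σ.im * (realSn (1 - m) σ.im * realDn (1 - m) σ.im * realDn m σ.re ^ 2) /
        jacobiDen m σ := by
    unfold epsIm jacobiDen
    ring
  have hr := Complex.abs_re_le_norm (jacobiEps m σ)
  have hi := Complex.abs_im_le_norm (jacobiEps m σ)
  rw [jacobiEps_re, e1] at hr
  rw [jacobiEps_im, e2] at hi
  have hDle : jacobiDen m σ ≤ (|realSn m σ.re| + |realCn (1 - m) σ.im|) ^ 2 := by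
    have hs1 : realSn (1 - m) σ.im ^ 2 ≤ 1 := Real.sin_sq_le_one _
    have : m * realSn m σ.re ^ 2 * realSn (1 - m) σ.im ^ 2 ≤ 1 * realSn m σ.re ^ 2 * 1 := by
      gcongr
      exact hm.2.le
    have h1 := sq_abs (realSn m σ.re)
    have h2 := sq_abs (realCn (1 - m) σ.im)
    have h3 := abs_nonneg (realSn m σ.re)
    have h4 := abs_nonneg (realCn (1 - m) σ.im)
    unfold jacobiDen
    nlinarith [mul_nonneg h3 h4]
  generalize realE m σ.re - (1 - m) * σ.re = A at *
  generalize m * σ.im - realE (1 - m) σ.im = B at *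
  generalize m * realCn m σ.re * realDn m σ.re * realSn (1 - m) σ.im ^ 2 = p at *
  generalize realSn (1 - m) σ.im * realDn (1 - m) σ.im * realDn m σ.re ^ 2 = q at *
  generalize realSn m σ.re = s at *
  generalize realCn (1 - m) σ.im = c at *
  generalize jacobiDen m σ = D at *
  have hsc : 0 < |s| + |c| := by
    rcases (add_nonneg (abs_nonneg s) (abs_nonneg c)).eq_or_lt with h | h
    · rw [← h] at hDle
      norm_num at hDle
      linarith
    · exact h
  have t1 : |s * p / D| ≤ |A + s * p / D| + |A| := by
    have := abs_sub (A + s * p / D) A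
    rwa [add_sub_cancel_left] at this
  have t2 : |c * q / D| ≤ |B + c * q / D| + |B| := by
    have := abs_sub (B + c * q / D) B
    rwa [add_sub_cancel_left] at this
  have t3 : 2 * |M| + |G| + 1 ≤ |s * p / D| + |c * q / D| := by
    rw [abs_div, abs_div, abs_of_pos hD, ← add_div, le_div_iff₀ hD, abs_mul, abs_mul]
    have hp : m / 2 ≤ |p| := g2.le.trans (le_abs_self p)
    have hq : m / 2 ≤ |q| := g3.le.trans (le_abs_self q)
    have b1 : (2 * |M| + |G| + 1) * (|s| + |c|) ≤ m / 2 := by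
      rw [hδ, lt_div_iff₀ (by positivity)] at g4
      linarith
    calc (2 * |M| + |G| + 1) * D ≤ (2 * |M| + |G| + 1) * (|s| + |c|) ^ 2 := by gcongr
      _ = (2 * |M| + |G| + 1) * (|s| + |c|) * (|s| + |c|) := by ring
      _ ≤ m / 2 * (|s| + |c|) := by gcongr
      _ = |s| * (m / 2) + |c| * (m / 2) := by ring
      _ ≤ |s| * |p| + |c| * |q| := by gcongr
  have := le_abs_self M
  have := le_abs_self G
  linarith

/-- The boundary of the rectangle `|Re σ| ≤ K`, `0 ≤ Im σ ≤ 2K'` is mapped into the rectangle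
`|Re w| ≤ E - m₁ K`, `-2 (E' - m K') ≤ Im w ≤ 0`. -/
lemma mem_sigmaRect_of_jacobiEps_mem {σ : ℂ} (hσ : σ ∈ sigmaClosedRect m)
    (h : jacobiEps m σ ∈ epsExterior m) : σ ∈ sigmaRect m := by
  obtain ⟨⟨h1, h2⟩, h3, h4⟩ := hσ
  have hm' := one_sub_mem_Ioo hm
  have hK := completeK_pos hm
  have hK' := completeK_pos hm'
  have hB := completeE_sub_pos' hm
  have hA := completeE_sub_pos hm
  simp only [epsExterior, Set.mem_ofPred_eq, jacobiEps_re, jacobiEps_im] at h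
  -- the horizontal sides
  have hor : ∀ x ∈ Set.Icc (-completeK m) (completeK m),
      -(completeE m - (1 - m) * completeK m) ≤ epsRe m x 0 ∧
        epsRe m x 0 ≤ completeE m - (1 - m) * completeK m ∧ epsIm m x 0 = 0 := by
    intro x hx
    have hmono := (strictMonoOn_realE_sub hm).monotoneOn
    have a := hmono (a := x) (b := completeK m) hx ⟨by linarith, le_rfl⟩ hx.2
    have b := hmono (a := -completeK m) (b := x) ⟨le_rfl, by linarith⟩ hx hx.1
    simp only [realE_neg hm, realE_completeK hm] at a b
    have e : epsRe m x 0 = realE m x - (1 - m) * x := by simp [epsRe, realSn_zero hm']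
    rw [e]
    exact ⟨by linarith, a, by simp [epsIm, realSn_zero hm', realE_zero hm']⟩
  -- the right-hand side
  have ver : ∀ y, 0 ≤ y → y ≤ 2 * completeK (1 - m) →
      epsRe m (completeK m) y = completeE m - (1 - m) * completeK m ∧
        epsIm m (completeK m) y ≤ 0 := by
    intro y hy0 hy1
    refine ⟨by simp [epsRe, realE_completeK hm, realCn_completeK hm], ?_⟩
    rcases hy0.eq_or_lt with rfl | hy0
    · simp [epsIm, realSn_zero hm', realE_zero hm']
    have hD : ∀ t ∈ Set.Icc (0 : ℝ) 1, 0 < jacobiDen m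
        ((completeK m : ℂ) + (t : ℂ) * ((⟨completeK m, y⟩ : ℂ) - completeK m)) := by
      rintro t ⟨ht0, ht1⟩
      refine jacobiDen_pos hm ?_ ?_ ?_ ?_ fun hh => ?_
      · simp; linarith
      · simp
      · simp; positivity
      · simp; nlinarith
      · have := congrArg Complex.re hh
        simp at this
        exact hK.ne' this
    have hN := re_mul_sub_mul_conj_pos (f := jacobiEps m) (f' := fun σ => m * jacobiCn m σ ^ 2)
      (p := completeK m) (q := ⟨completeK m, y⟩) (c := -1) ?_
      (fun t ht => hasDerivAt_jacobiEps hm (hD t ht).ne') ?_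
    · have e2 : epsIm m (completeK m) 0 = 0 := by
        simp [epsIm, realE_zero hm', realSn_zero hm']
      simp [jacobiEps_re, jacobiEps_im, e2] at hN
      nlinarith
    · intro hh
      have := congrArg Complex.im hh
      simp at this
      exact hy0.ne this
    · intro t ht
      have hD' := hD t (Set.Ioo_subset_Icc_self ht)
      rw [neg_one_mul, Complex.neg_re, mul_jacobiCn_sq_re, ← neg_div]
      refine div_pos ?_ (by positivity)
      have := realDn_pos hm (completeK m)
      have := realDn_pos hm' (t * y)
      have := realSn_pos hm' (x := t * y) (mul_pos ht.1 hy0) (by nlinarith [ht.1, ht.2])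
      have := hm.1
      simp [realCn_completeK hm, realSn_completeK hm]
      positivity
  refine ⟨lt_of_le_of_ne h1 fun e => h ?_, lt_of_le_of_ne h2 fun e => h ?_,
    lt_of_le_of_ne h3 fun e => h ?_, lt_of_le_of_ne h4 fun e => h ?_⟩
  · obtain ⟨a, b⟩ := ver σ.im h3 h4
    obtain ⟨-, c⟩ := ver (2 * completeK (1 - m) - σ.im) (by linarith) (by linarith)
    rw [epsIm_two_mul_completeK_sub hm] at c
    rw [← e, epsRe_neg hm, epsIm_neg hm, a]
    exact ⟨le_rfl, by linarith, by linarith, b⟩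
  · obtain ⟨a, b⟩ := ver σ.im h3 h4
    obtain ⟨-, c⟩ := ver (2 * completeK (1 - m) - σ.im) (by linarith) (by linarith)
    rw [epsIm_two_mul_completeK_sub hm] at c
    rw [e, a]
    exact ⟨by linarith, le_rfl, by linarith, b⟩
  · obtain ⟨a, b, c⟩ := hor σ.re ⟨h1, h2⟩
    rw [← e]
    exact ⟨a, b, by linarith, c.le⟩
  · obtain ⟨a, b, c⟩ := hor σ.re ⟨h1, h2⟩
    rw [e, ← sub_zero (2 * completeK (1 - m)), epsRe_two_mul_completeK_sub hm,
      epsIm_two_mul_completeK_sub hm, c]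
    exact ⟨a, b, by linarith, by linarith⟩

omit hm in
lemma isOpen_sigmaDomain (m : ℝ) : IsOpen (sigmaDomain m) := by
  have : sigmaDomain m = sigmaRect m ∩ {Complex.I * (completeK (1 - m) : ℂ)}ᶜ := by
    ext σ
    exact mem_sigmaDomain_iff
  rw [this]
  exact (isOpen_sigmaRect m).inter isOpen_compl_singleton

lemma jacobiDen_pos_of_mem {σ : ℂ} (hσ : σ ∈ sigmaDomain m) : 0 < jacobiDen m σ :=
  jacobiDen_pos hm hσ.1.le hσ.2.1.le hσ.2.2.1.le hσ.2.2.2.1.le hσ.2.2.2.2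

/-- `cn` vanishes only at the corners of the rectangle. -/
lemma mul_jacobiCn_sq_ne_zero {σ : ℂ} (hσ : σ ∈ sigmaDomain m) :
    (m : ℂ) * jacobiCn m σ ^ 2 ≠ 0 := by
  have hm' := one_sub_mem_Ioo hm
  have hD := jacobiDen_pos_of_mem hm hσ
  have hc := realCn_pos hm hσ.1 hσ.2.1
  have hs' := realSn_pos hm' hσ.2.2.1 hσ.2.2.2.1
  have hd := realDn_pos hm σ.re
  have hd' := realDn_pos hm' σ.im
  intro h
  have h0 : jacobiCn m σ = 0 := by
    have hm0 : (m : ℂ) ≠ 0 := by exact_mod_cast hm.1.ne'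
    exact pow_eq_zero_iff two_ne_zero |>.1 ((mul_eq_zero.1 h).resolve_left hm0)
  unfold jacobiCn at h0
  have hD' : (jacobiDen m σ : ℂ) ≠ 0 := by exact_mod_cast hD.ne'
  have hN := (div_eq_zero_iff.1 h0).resolve_right hD'
  have hre := congrArg Complex.re hN
  have him := congrArg Complex.im hN
  simp only [Complex.sub_re, Complex.sub_im, Complex.ofReal_re, Complex.ofReal_im,
    Complex.I_mul_re, Complex.I_mul_im, Complex.zero_re, Complex.zero_im, neg_zero, sub_zero,
    zero_sub, neg_eq_zero] at hre him
  have hc1 : realCn (1 - m) σ.im = 0 := (mul_eq_zero.1 hre).resolve_left hc.ne'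
  have hs1 : realSn m σ.re = 0 := by
    have a := (mul_eq_zero.1 him).resolve_right hd'.ne'
    have b := (mul_eq_zero.1 a).resolve_right hs'.ne'
    exact (mul_eq_zero.1 b).resolve_right hd.ne'
  unfold jacobiDen at hD
  rw [hc1, hs1] at hD
  simp at hD

lemma bijOn_jacobiEps : Set.BijOn (jacobiEps m) (sigmaDomain m) (epsExterior m) := by
  have hK := completeK_pos hm
  have hK' := completeK_pos (one_sub_mem_Ioo hm)
  refine ⟨mapsTo_jacobiEps hm, injOn_jacobiEps hm, ?_⟩
  refine surjOn_of_isPreconnected (isOpen_sigmaDomain m)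
    ⟨⟨0, completeK (1 - m) / 2⟩, by simpa using hK, hK, by simpa using hK',
      by simp only; linarith, fun h => by
        have := congrArg Complex.im h
        simp at this
        linarith⟩
    (fun σ hσ => hasDerivAt_jacobiEps hm (jacobiDen_pos_of_mem hm hσ).ne')
    (fun σ hσ => mul_jacobiCn_sq_ne_zero hm hσ)
    (isPreconnected_compl_reProdIm_Icc _ _ _ _) (mapsTo_jacobiEps hm) fun p hp => ?_
  obtain ⟨δ, hδ, hball⟩ := Metric.eventually_nhds_iff.1
    (eventually_le_norm_jacobiEps hm (‖p‖ + 1))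
  refine ⟨sigmaClosedRect m \ Metric.ball (Complex.I * (completeK (1 - m) : ℂ)) δ,
    (isCompact_sigmaClosedRect m).diff Metric.isOpen_ball, ?_, ?_, 1, one_pos, ?_⟩
  · rintro σ ⟨⟨⟨h1, h2⟩, h3, h4⟩, h5⟩
    refine (hasDerivAt_jacobiEps hm (jacobiDen_pos hm h1 h2 h3 h4 ?_).ne').continuousAt
      |>.continuousWithinAt
    rintro rfl
    exact h5 (Metric.mem_ball_self hδ)
  · rintro σ ⟨h1, h2⟩ h3
    refine mem_sigmaDomain_iff.2 ⟨mem_sigmaRect_of_jacobiEps_mem hm h1 h3, ?_⟩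
    rintro rfl
    exact h2 (Metric.mem_ball_self hδ)
  · intro σ hσ hC
    have hσb : dist σ (Complex.I * (completeK (1 - m) : ℂ)) < δ := by
      by_contra hnot
      exact hC ⟨sigmaRect_subset m (mem_sigmaDomain_iff.1 hσ).1, hnot⟩
    have h1 := hball hσb (jacobiDen_pos_of_mem hm hσ)
    rw [dist_eq_norm]
    have := norm_sub_norm_le (jacobiEps m σ) p
    linarith

end

/-! ### The parameter -/

/-- The integral `∫₀^{π/2} m cos² θ (1 - m sin² θ)^{-1/2} dθ`, which is `E - m₁ K` for `0 < m < 1`;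
in this form it is continuous and increasing in `m` on all of `[0, 1]`. -/
noncomputable def epsK (m : ℝ) : ℝ :=
  ∫ θ in (0 : ℝ)..(Real.pi / 2), m * Real.cos θ ^ 2 / √(1 - m * Real.sin θ ^ 2)

lemma epsK_eq {m : ℝ} (hm : m ∈ Set.Ioo (0 : ℝ) 1) :
    epsK m = completeE m - (1 - m) * completeK m := by
  have h1 : Continuous fun θ : ℝ => 1 / √(1 - m * Real.sin θ ^ 2) := by
    refine Continuous.div continuous_const (by fun_prop) fun θ => ?_
    exact (Real.sqrt_pos.2 (one_sub_mul_sin_sq_pos hm θ)).ne'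
  have h2 : Continuous fun θ : ℝ => √(1 - m * Real.sin θ ^ 2) := by fun_prop
  unfold epsK completeE completeK ellipticIncE ellipticF
  rw [← intervalIntegral.integral_const_mul, ← intervalIntegral.integral_sub
    (h2.intervalIntegrable _ _) ((h1.const_mul _).intervalIntegrable _ _)]
  refine intervalIntegral.integral_congr fun θ _ => ?_
  have h := one_sub_mul_sin_sq_pos hm θ
  have h' := Real.sqrt_pos.2 h
  have hsq := Real.sq_sqrt h.le
  have hcs := Real.sin_sq_add_cos_sq θ
  rw [mul_one_div, eq_sub_iff_add_eq, ← add_div, div_eq_iff h'.ne', ← sq, hsq]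
  linear_combination m * hcs

lemma epsK_integrand_nonneg {m θ : ℝ} (h0 : 0 ≤ m) :
    0 ≤ m * Real.cos θ ^ 2 / √(1 - m * Real.sin θ ^ 2) := by positivity

lemma epsK_integrand_le_one {m θ : ℝ} (h0 : 0 ≤ m) (h1 : m ≤ 1) :
    m * Real.cos θ ^ 2 / √(1 - m * Real.sin θ ^ 2) ≤ 1 := by
  rcases (Real.sqrt_nonneg (1 - m * Real.sin θ ^ 2)).eq_or_lt with h | h
  · rw [← h, div_zero]
    exact zero_le_one
  · rw [div_le_one h]
    have hcs := Real.sin_sq_add_cos_sq θ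
    refine Real.le_sqrt_of_sq_le ?_
    have hc1 : Real.cos θ ^ 2 ≤ 1 := Real.cos_sq_le_one θ
    have hc0 := sq_nonneg (Real.cos θ)
    have hs0 := sq_nonneg (Real.sin θ)
    have : (m * Real.cos θ ^ 2) ^ 2 ≤ Real.cos θ ^ 2 := by
      have h2 : m * Real.cos θ ^ 2 ≤ 1 * Real.cos θ ^ 2 := by gcongr
      have h3 : 0 ≤ m * Real.cos θ ^ 2 := by positivity
      nlinarith
    nlinarith

lemma continuousOn_epsK : ContinuousOn epsK (Set.Icc 0 1) := by
  intro m hm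
  refine intervalIntegral.continuousWithinAt_of_dominated_interval (bound := fun _ => 1) ?_ ?_
    (by simp) ?_
  · refine Filter.Eventually.of_forall fun m => Measurable.aestronglyMeasurable ?_
    fun_prop
  · filter_upwards [self_mem_nhdsWithin] with m hm
    refine Filter.Eventually.of_forall fun θ _ => ?_
    rw [Real.norm_of_nonneg (epsK_integrand_nonneg hm.1)]
    exact epsK_integrand_le_one hm.1 hm.2
  · -- The integrand is discontinuous in `m` only at `m = 1`, `θ = π / 2`.
    have hne : ∀ᵐ θ : ℝ, θ ≠ Real.pi / 2 := by
      simp [MeasureTheory.ae_iff]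
    filter_upwards [hne] with θ hθ hmem
    rw [Set.uIoc_of_le (by positivity)] at hmem
    have hcos : 0 < Real.cos θ := Real.cos_pos_of_mem_Ioo
      ⟨by linarith [hmem.1, Real.pi_pos], lt_of_le_of_ne hmem.2 hθ⟩
    have hpos : 0 < 1 - m * Real.sin θ ^ 2 := by
      have := Real.sin_sq_add_cos_sq θ
      nlinarith [hm.2, sq_nonneg (Real.sin θ)]
    refine ContinuousAt.continuousWithinAt (ContinuousAt.div (by fun_prop) (by fun_prop) ?_)
    exact (Real.sqrt_pos.2 hpos).ne'

lemma strictMonoOn_epsK : StrictMonoOn epsK (Set.Icc 0 1) := by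
  intro m hm n hn hmn
  have hint : ∀ m ∈ Set.Icc (0 : ℝ) 1, IntervalIntegrable
      (fun θ => m * Real.cos θ ^ 2 / √(1 - m * Real.sin θ ^ 2)) MeasureTheory.volume
      0 (Real.pi / 2) := fun m hm => by
    refine IntervalIntegrable.mono_fun
      (g := fun θ => m * Real.cos θ ^ 2 / √(1 - m * Real.sin θ ^ 2))
      (f := fun _ => (1 : ℝ)) (by simp) (Measurable.aestronglyMeasurable (by fun_prop)) ?_
    refine Filter.Eventually.of_forall fun θ => ?_
    dsimp only
    rw [Real.norm_of_nonneg (epsK_integrand_nonneg hm.1), norm_one]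
    exact epsK_integrand_le_one hm.1 hm.2
  unfold epsK
  rw [← sub_pos, ← intervalIntegral.integral_sub (hint n hn) (hint m hm)]
  refine intervalIntegral.intervalIntegral_pos_of_pos_on ((hint n hn).sub (hint m hm)) ?_
    (by positivity)
  intro θ hθ
  have hcos : 0 < Real.cos θ := Real.cos_pos_of_mem_Ioo ⟨by linarith [hθ.1, Real.pi_pos], hθ.2⟩
  have hcs := Real.sin_sq_add_cos_sq θ
  have hs := sq_nonneg (Real.sin θ)
  have hpos : 0 < 1 - n * Real.sin θ ^ 2 := by nlinarith [hn.2]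
  have hle : 1 - n * Real.sin θ ^ 2 ≤ 1 - m * Real.sin θ ^ 2 := by gcongr
  have hsn := Real.sqrt_pos.2 hpos
  have hsm := Real.sqrt_pos.2 (hpos.trans_le hle)
  have h0 : 0 ≤ m := hm.1
  rw [sub_pos]
  calc m * Real.cos θ ^ 2 / √(1 - m * Real.sin θ ^ 2)
      < n * Real.cos θ ^ 2 / √(1 - m * Real.sin θ ^ 2) := by gcongr
    _ ≤ n * Real.cos θ ^ 2 / √(1 - n * Real.sin θ ^ 2) := by
      have : 0 ≤ n := hn.1
      gcongr

lemma isRectParameter_iff {a b c m : ℝ} (hab : a < b) (hc : 0 < c) :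
    IsRectParameter a b c m ↔ m ∈ Set.Ioo (0 : ℝ) 1 ∧
      (b - a) / 2 * epsK m - c * epsK (1 - m) = 0 := by
  have hα : 0 < (b - a) / 2 := by linarith
  unfold IsRectParameter
  rw [← and_assoc]
  refine and_congr_right fun hm => ?_
  rw [epsK_eq hm, epsK_eq (one_sub_mem_Ioo hm), sub_sub_cancel, div_eq_div_iff hc.ne' hα.ne']
  constructor <;> intro h <;> linarith

lemma existsUnique_isRectParameter {a b c : ℝ} (hab : a < b) (hc : 0 < c) :
    ∃! m : ℝ, IsRectParameter a b c m := by
  have hα : 0 < (b - a) / 2 := by linarith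
  have h0 : (0 : ℝ) ∈ Set.Icc (0 : ℝ) 1 := ⟨le_rfl, zero_le_one⟩
  have h1 : (1 : ℝ) ∈ Set.Icc (0 : ℝ) 1 := ⟨zero_le_one, le_rfl⟩
  have hsymm : ∀ m ∈ Set.Icc (0 : ℝ) 1, 1 - m ∈ Set.Icc (0 : ℝ) 1 := fun m hm =>
    ⟨by linarith [hm.2], by linarith [hm.1]⟩
  have hmono : StrictMonoOn (fun m => (b - a) / 2 * epsK m - c * epsK (1 - m)) (Set.Icc 0 1) := by
    intro m hm n hn hmn
    have e1 := mul_lt_mul_of_pos_left (strictMonoOn_epsK hm hn hmn) hα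
    have e2 := mul_lt_mul_of_pos_left (strictMonoOn_epsK (hsymm n hn) (hsymm m hm)
      (sub_lt_sub_left hmn 1)) hc
    dsimp only
    linarith
  have hcont : ContinuousOn (fun m => (b - a) / 2 * epsK m - c * epsK (1 - m)) (Set.Icc 0 1) :=
    (continuousOn_epsK.const_mul _).sub
      ((continuousOn_epsK.comp (by fun_prop) hsymm).const_mul _)
  have hz : epsK 0 = 0 := by simp [epsK]
  have hp : 0 < epsK 1 := hz ▸ strictMonoOn_epsK h0 h1 zero_lt_one
  obtain ⟨m, hm, hm0⟩ := intermediate_value_Ioo (zero_le_one' ℝ) hcont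
    (show (0 : ℝ) ∈ _ by
      simp only [hz, sub_zero, sub_self, mul_zero, zero_sub]
      exact ⟨neg_lt_zero.2 (mul_pos hc hp), mul_pos hα hp⟩)
  refine ⟨m, (isRectParameter_iff hab hc).2 ⟨hm, hm0⟩, fun n hn => ?_⟩
  obtain ⟨hn1, hn0⟩ := (isRectParameter_iff hab hc).1 hn
  exact hmono.injOn (Set.Ioo_subset_Icc_self hn1) (Set.Ioo_subset_Icc_self hm) (hn0.trans hm0.symm)

/-! ### The conformal map and its inverse in the coordinate `σ` -/

section

variable {m : ℝ} (hm : m ∈ Set.Ioo (0 : ℝ) 1)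
include hm

lemma diskCoordDeriv_eq {σ : ℂ} (hσ : jacobiDen m σ ≠ 0) :
    diskCoordDeriv m σ = Complex.I * (√m : ℝ) * jacobiCn m σ * diskCoord m σ := by
  have e1 := realSn_sq_add_realCn_sq m σ.re
  have e2 := realDn_sq hm σ.re
  have e3 := realSn_sq_add_realCn_sq (1 - m) σ.im
  have e4 := realDn_sq (one_sub_mem_Ioo hm) σ.im
  have e5 : √m ^ 2 = m := Real.sq_sqrt hm.1.le
  have hD := jacobiDen_eq_mul hm σ
  have hP : diskDen m σ ≠ 0 := fun h => hσ (by rw [hD, h, mul_zero])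
  have hPdef : diskDen m σ =
    realDn (1 - m) σ.im + √m * realCn m σ.re * realSn (1 - m) σ.im := rfl
  have hP' : (diskDen m σ : ℂ) ≠ 0 := by exact_mod_cast hP
  have hQ : (realDn (1 - m) σ.im - √m * realCn m σ.re * realSn (1 - m) σ.im) ≠ 0 :=
    fun h => hσ (by rw [hD, h, zero_mul])
  unfold diskCoordDeriv jacobiCn diskCoord
  rw [hD]
  generalize diskDen m σ = P at *
  generalize hQdef : realDn (1 - m) σ.im - √m * realCn m σ.re * realSn (1 - m) σ.im = Q at *
  have hQ' : (Q : ℂ) ≠ 0 := by exact_mod_cast hQ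
  push_cast
  field_simp
  apply Complex.ext
  · simp
    grind
  · simp
    grind

lemma hasDerivAt_epsIm_zero {y : ℝ} (hc : realCn (1 - m) y ≠ 0) :
    HasDerivAt (epsIm m 0) (m / realCn (1 - m) y ^ 2) y := by
  have hm' := one_sub_mem_Ioo hm
  have e : epsIm m 0 = fun y => m * y - realE (1 - m) y +
      realSn (1 - m) y * realCn (1 - m) y * realDn (1 - m) y / realCn (1 - m) y ^ 2 := by
    ext y
    simp [epsIm, realSn_zero hm, realDn_zero hm]
  have hs' := hasDerivAt_realSn hm' y
  have hc' := hasDerivAt_realCn hm' y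
  have hd' := hasDerivAt_realDn hm' y
  rw [e]
  refine ((((hasDerivAt_id' y).const_mul m).fun_sub (hasDerivAt_realE hm' y)).fun_add
    (((hs'.fun_mul hc').fun_mul hd').fun_div (hc'.fun_pow 2) (pow_ne_zero 2 hc))).congr_deriv ?_
  have e3 := realSn_sq_add_realCn_sq (1 - m) y
  have e4 := realDn_sq hm' y
  clear hs' hc' hd' e
  simp only [Nat.cast_ofNat, Nat.add_one_sub_one, pow_one]
  generalize realSn (1 - m) y = s at *
  generalize realCn (1 - m) y = c at *
  generalize realDn (1 - m) y = d at *
  field_simp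
  grind

/-- The substitution `t = √m sn₁(y) / cn₁(y)` in the integral for `Ψ̃(-r)`. -/
lemma epsIm_zero_eq_integral {y : ℝ} (h0 : 0 ≤ y) (h1 : y < completeK (1 - m)) :
    epsIm m 0 y = ∫ t in (0 : ℝ)..(√m * realSn (1 - m) y / realCn (1 - m) y),
      √(m + t ^ 2) / √(1 + t ^ 2) := by
  have hm' := one_sub_mem_Ioo hm
  have hK' := completeK_pos hm'
  have hcont : Continuous fun t : ℝ => √(m + t ^ 2) / √(1 + t ^ 2) :=
    Continuous.div (by fun_prop) (by fun_prop) fun t => (Real.sqrt_pos.2 (by positivity)).ne'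
  have hI : ∀ x, HasDerivAt (fun x => ∫ t in (0 : ℝ)..x, √(m + t ^ 2) / √(1 + t ^ 2))
      (√(m + x ^ 2) / √(1 + x ^ 2)) x := fun x =>
    intervalIntegral.integral_hasDerivAt_right (hcont.intervalIntegrable _ _)
      hcont.aestronglyMeasurable.stronglyMeasurableAtFilter hcont.continuousAt
  have hd : ∀ x ∈ Set.uIcc 0 y, HasDerivAt (fun x => epsIm m 0 x -
      ∫ t in (0 : ℝ)..(√m * realSn (1 - m) x / realCn (1 - m) x), √(m + t ^ 2) / √(1 + t ^ 2))
      0 x := by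
    intro x hx
    rw [Set.uIcc_of_le h0] at hx
    have hc := realCn_pos hm' (x := x) (by linarith [hx.1]) (by linarith [hx.2])
    have hd := realDn_pos hm' x
    have hT := ((hasDerivAt_realSn hm' x).const_mul √m).fun_div (hasDerivAt_realCn hm' x) hc.ne'
    refine ((hasDerivAt_epsIm_zero hm hc.ne').fun_sub ((hI _).comp x hT)).congr_deriv ?_
    have e3 := realSn_sq_add_realCn_sq (1 - m) x
    have e4 := realDn_sq hm' x
    have e5 : √m ^ 2 = m := Real.sq_sqrt hm.1.le
    have a1 : m + (√m * realSn (1 - m) x / realCn (1 - m) x) ^ 2 =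
        (√m / realCn (1 - m) x) ^ 2 := by
      rw [div_pow, div_pow, mul_pow, e5]
      field_simp
      linear_combination m * e3
    have a2 : 1 + (√m * realSn (1 - m) x / realCn (1 - m) x) ^ 2 =
        (realDn (1 - m) x / realCn (1 - m) x) ^ 2 := by
      rw [div_pow, div_pow, mul_pow, e5, e4]
      field_simp
      linear_combination e3
    rw [a1, a2, Real.sqrt_sq (by positivity), Real.sqrt_sq (by positivity)]
    field_simp
    rw [e5, sub_neg_eq_add]
    linear_combination (-m) * e3
  have h := intervalIntegral.integral_eq_sub_of_hasDerivAt hd (by simp)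
  have e0 : epsIm m 0 0 = 0 := by simp [epsIm, realSn_zero hm', realE_zero hm']
  simp only [intervalIntegral.integral_zero, realSn_zero hm', e0, mul_zero, zero_div,
    intervalIntegral.integral_same, sub_zero] at h
  linarith

end

section

variable {a b c m : ℝ}

lemma rectLambda_pos (hc : 0 < c) (h : IsRectParameter a b c m) : 0 < rectLambda c m :=
  div_pos (completeE_sub_pos ⟨h.1, h.2.1⟩) hc

lemma rectLambda_mul (hc : 0 < c) : rectLambda c m * c = completeE m - (1 - m) * completeK m :=
  div_mul_cancel₀ _ hc.ne'

lemma rectLambda_mul' (hab : a < b) (h : IsRectParameter a b c m) :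
    rectLambda c m * ((b - a) / 2) = completeE (1 - m) - m * completeK (1 - m) := by
  have hα : 0 < (b - a) / 2 := by linarith
  unfold rectLambda
  rw [h.2.2, div_mul_cancel₀ _ hα.ne']

/-- The point of the exterior of `[a, b] × [-c, c]` with parameter `σ`. -/
noncomputable def rectPoint (a b c m : ℝ) (σ : ℂ) : ℂ :=
  zOfSigma a b c m σ + (((a + b) / 2 : ℝ) : ℂ)

lemma zOfSigma_eq (hm : m ∈ Set.Ioo (0 : ℝ) 1) {σ : ℂ} (hσ : σ ∈ sigmaDomain m) :
    zOfSigma a b c m σ =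
      (((b - a) / 2 : ℝ) : ℂ) - Complex.I / (rectLambda c m : ℂ) * jacobiEps m σ := by
  unfold zOfSigma
  rw [jacobiE_eq hm hσ]

lemma rectPoint_re (hm : m ∈ Set.Ioo (0 : ℝ) 1) {σ : ℂ} (hσ : σ ∈ sigmaDomain m) :
    (rectPoint a b c m σ).re = b + epsIm m σ.re σ.im / rectLambda c m := by
  rw [rectPoint, zOfSigma_eq hm hσ, div_mul_eq_mul_div]
  simp only [Complex.add_re, Complex.sub_re, Complex.ofReal_re, Complex.div_ofReal_re,
    Complex.I_mul_re, jacobiEps_im]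
  ring

lemma rectPoint_im (hm : m ∈ Set.Ioo (0 : ℝ) 1) {σ : ℂ} (hσ : σ ∈ sigmaDomain m) :
    (rectPoint a b c m σ).im = -(epsRe m σ.re σ.im / rectLambda c m) := by
  rw [rectPoint, zOfSigma_eq hm hσ, div_mul_eq_mul_div]
  simp only [Complex.add_im, Complex.sub_im, Complex.ofReal_im, Complex.div_ofReal_im,
    Complex.I_mul_im, jacobiEps_re]
  ring

lemma hasDerivAt_zOfSigma (hm : m ∈ Set.Ioo (0 : ℝ) 1) {σ : ℂ} (hσ : σ ∈ sigmaDomain m) :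
    HasDerivAt (zOfSigma a b c m)
      (-(Complex.I / (rectLambda c m : ℂ) * (m * jacobiCn m σ ^ 2))) σ := by
  have h := ((hasDerivAt_jacobiEps hm (jacobiDen_pos_of_mem hm hσ).ne').const_mul
    (Complex.I / (rectLambda c m : ℂ))).const_sub (((b - a) / 2 : ℝ) : ℂ)
  refine h.congr_of_eventuallyEq ?_
  filter_upwards [(isOpen_sigmaDomain m).mem_nhds hσ] with τ hτ using zOfSigma_eq hm hτ

lemma bijOn_rectPoint (hab : a < b) (hc : 0 < c) (h : IsRectParameter a b c m) :
    Set.BijOn (rectPoint a b c m) (sigmaDomain m) (rectExterior a b c) := by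
  have hm : m ∈ Set.Ioo (0 : ℝ) 1 := ⟨h.1, h.2.1⟩
  have hl := rectLambda_pos hc h
  have e1 := rectLambda_mul (m := m) hc
  have e2 := rectLambda_mul' hab h
  -- `w ↦ b - (i / λ) w` maps `epsExterior` onto the exterior of `[a, b] × [-c, c]`.
  have key : ∀ w z : ℂ, z.re = b + w.im / rectLambda c m → z.im = -(w.re / rectLambda c m) →
      (w ∈ epsExterior m ↔ z ∈ rectExterior a b c) := by
    intro w z hre him
    have hre' : w.im = rectLambda c m * (z.re - b) := by rw [hre]; field_simp; ring
    have him' : w.re = -(rectLambda c m * z.im) := by rw [him]; field_simp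
    simp only [epsExterior, rectExterior, Set.mem_ofPred_eq, hre', him', ← e1, ← e2]
    refine not_congr ?_
    constructor
    · rintro ⟨h1, h2, h3, h4⟩
      refine ⟨?_, ?_, ?_, ?_⟩
      · refine le_of_mul_le_mul_left (a := rectLambda c m) ?_ hl; linarith
      · refine le_of_mul_le_mul_left (a := rectLambda c m) ?_ hl; linarith
      · refine le_of_mul_le_mul_left (a := rectLambda c m) ?_ hl; linarith
      · refine le_of_mul_le_mul_left (a := rectLambda c m) ?_ hl; linarith
    · rintro ⟨h1, h2, h3, h4⟩
      have t1 := mul_le_mul_of_nonneg_left h1 hl.le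
      have t2 := mul_le_mul_of_nonneg_left h2 hl.le
      have t3 := mul_le_mul_of_nonneg_left h3 hl.le
      have t4 := mul_le_mul_of_nonneg_left h4 hl.le
      refine ⟨?_, ?_, ?_, ?_⟩ <;> linarith
  have hbij := bijOn_jacobiEps hm
  refine ⟨fun σ hσ => ?_, fun σ hσ τ hτ hστ => ?_, fun z hz => ?_⟩
  · refine (key (jacobiEps m σ) _ ?_ ?_).1 (hbij.mapsTo hσ)
    · rw [rectPoint_re hm hσ, jacobiEps_im]
    · rw [rectPoint_im hm hσ, jacobiEps_re]
  · refine hbij.injOn hσ hτ (Complex.ext ?_ ?_)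
    · have := congrArg Complex.im hστ
      rw [rectPoint_im hm hσ, rectPoint_im hm hτ, neg_inj, div_left_inj' hl.ne'] at this
      simpa only [jacobiEps_re] using this
    · have := congrArg Complex.re hστ
      rw [rectPoint_re hm hσ, rectPoint_re hm hτ, add_right_inj, div_left_inj' hl.ne'] at this
      simpa only [jacobiEps_im] using this
  · obtain ⟨σ, hσ, hw⟩ := hbij.surjOn
      ((key ⟨-(rectLambda c m * z.im), rectLambda c m * (z.re - b)⟩ z
        (by simp only; field_simp; ring) (by simp only; field_simp)).2 hz)
    refine ⟨σ, hσ, Complex.ext ?_ ?_⟩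
    · rw [rectPoint_re hm hσ, ← jacobiEps_im, hw]
      field_simp
      ring
    · rw [rectPoint_im hm hσ, ← jacobiEps_re, hw]
      field_simp

lemma leftInvOn_invFunOn_zOfSigma (hab : a < b) (hc : 0 < c) (h : IsRectParameter a b c m) :
    Set.LeftInvOn (Function.invFunOn (zOfSigma a b c m) (sigmaDomain m)) (zOfSigma a b c m)
      (sigmaDomain m) := by
  refine Set.InjOn.leftInvOn_invFunOn fun σ hσ τ hτ hστ => ?_
  refine (bijOn_rectPoint hab hc h).injOn hσ hτ ?_
  unfold rectPoint
  rw [hστ]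

lemma phi₁_rectPoint (σ : ℂ) : phi₁ a b (rectPoint a b c m σ) = zOfSigma a b c m σ := by
  unfold phi₁ rectPoint
  ring

/-- In the coordinate `σ` the map `Φ̃` is the reciprocal of `diskCoord`. -/
lemma rectPhi_rectPoint (hab : a < b) (hc : 0 < c) (h : IsRectParameter a b c m) {σ : ℂ}
    (hσ : σ ∈ sigmaDomain m) : rectPhi a b c m (rectPoint a b c m σ) = (diskCoord m σ)⁻¹ := by
  rw [rectPhi, Function.comp_apply, Function.comp_apply, phi₁_rectPoint, phi₂,
    leftInvOn_invFunOn_zOfSigma hab hc h hσ, phi₃_wOfSigma ⟨h.1, h.2.1⟩ hσ]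

lemma diskCoord_ne_zero (hm : m ∈ Set.Ioo (0 : ℝ) 1) {σ : ℂ} (hσ : σ ∈ sigmaDomain m) :
    diskCoord m σ ≠ 0 := by
  have hm' := one_sub_mem_Ioo hm
  obtain ⟨h1, h2⟩ := mem_sigmaDomain_iff.1 hσ
  have h0 : diskCoord m (Complex.I * (completeK (1 - m) : ℂ)) = 0 := by
    simp [diskCoord, realCn_completeK hm', realSn_zero hm]
  exact fun h => h2 (injOn_diskCoord hm h1 (I_mul_completeK_mem hm) (h.trans h0.symm))

lemma exists_diskCoord_eq_inv (hm : m ∈ Set.Ioo (0 : ℝ) 1) {u : ℂ} (hu : 1 < ‖u‖) :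
    ∃ σ ∈ sigmaDomain m, diskCoord m σ = u⁻¹ := by
  have hu0 : u ≠ 0 := norm_pos_iff.1 (by linarith)
  obtain ⟨σ, hσ, e⟩ := (bijOn_diskCoord hm).surjOn (show u⁻¹ ∈ Metric.ball (0 : ℂ) 1 by
    rw [mem_ball_zero_iff, norm_inv]
    exact inv_lt_one_of_one_lt₀ hu)
  refine ⟨σ, mem_sigmaDomain_iff.2 ⟨hσ, ?_⟩, e⟩
  rintro rfl
  have hm' := one_sub_mem_Ioo hm
  have h0 : diskCoord m (Complex.I * (completeK (1 - m) : ℂ)) = 0 := by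
    simp [diskCoord, realCn_completeK hm', realSn_zero hm]
  exact inv_ne_zero hu0 (e.symm.trans h0)

lemma one_lt_norm_inv_diskCoord (hm : m ∈ Set.Ioo (0 : ℝ) 1) {σ : ℂ} (hσ : σ ∈ sigmaDomain m) :
    1 < ‖(diskCoord m σ)⁻¹‖ := by
  rw [norm_inv]
  exact (one_lt_inv₀ (norm_pos_iff.2 (diskCoord_ne_zero hm hσ))).2
    (norm_diskCoord_lt_one hm hσ.1 hσ.2.1 hσ.2.2.1 hσ.2.2.2.1)

lemma bijOn_rectPhi (hab : a < b) (hc : 0 < c) (h : IsRectParameter a b c m) :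
    Set.BijOn (rectPhi a b c m) (rectExterior a b c) {u : ℂ | 1 < ‖u‖} := by
  have hm : m ∈ Set.Ioo (0 : ℝ) 1 := ⟨h.1, h.2.1⟩
  have hbij := bijOn_rectPoint hab hc h
  refine ⟨fun z hz => ?_, fun z hz w hw hzw => ?_, fun u hu => ?_⟩
  · obtain ⟨σ, hσ, rfl⟩ := hbij.surjOn hz
    rw [rectPhi_rectPoint hab hc h hσ]
    exact one_lt_norm_inv_diskCoord hm hσ
  · obtain ⟨σ, hσ, rfl⟩ := hbij.surjOn hz
    obtain ⟨τ, hτ, rfl⟩ := hbij.surjOn hw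
    rw [rectPhi_rectPoint hab hc h hσ, rectPhi_rectPoint hab hc h hτ, inv_inj] at hzw
    rw [injOn_diskCoord hm (mem_sigmaDomain_iff.1 hσ).1 (mem_sigmaDomain_iff.1 hτ).1 hzw]
  · obtain ⟨σ, hσ, e⟩ := exists_diskCoord_eq_inv hm hu
    exact ⟨_, hbij.mapsTo hσ, by rw [rectPhi_rectPoint hab hc h hσ, e, inv_inv]⟩

lemma differentiableOn_rectPhi (hab : a < b) (hc : 0 < c) (h : IsRectParameter a b c m) :
    DifferentiableOn ℂ (rectPhi a b c m) (rectExterior a b c) := by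
  have hm : m ∈ Set.Ioo (0 : ℝ) 1 := ⟨h.1, h.2.1⟩
  have hl := rectLambda_pos hc h
  have hbij := bijOn_rectPoint hab hc h
  have heq : Set.EqOn (rectPhi a b c m) (fun z => (diskCoord m
      (Function.invFunOn (zOfSigma a b c m) (sigmaDomain m) (phi₁ a b z)))⁻¹)
      (rectExterior a b c) := by
    intro z hz
    obtain ⟨σ, hσ, rfl⟩ := hbij.surjOn hz
    dsimp only
    rw [rectPhi_rectPoint hab hc h hσ, phi₁_rectPoint, leftInvOn_invFunOn_zOfSigma hab hc h hσ]
  refine DifferentiableOn.congr (fun z hz => ?_) heq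
  obtain ⟨σ, hσ, rfl⟩ := hbij.surjOn hz
  have hl' : (rectLambda c m : ℂ) ≠ 0 := by exact_mod_cast hl.ne'
  have hinv := hasDerivAt_of_leftInvOn (isOpen_sigmaDomain m)
    (fun τ hτ => hasDerivAt_zOfSigma (a := a) (b := b) (c := c) hm hτ)
    (fun τ hτ => neg_ne_zero.2 (mul_ne_zero (div_ne_zero Complex.I_ne_zero hl')
      (mul_jacobiCn_sq_ne_zero hm hτ))) (leftInvOn_invFunOn_zOfSigma hab hc h) hσ
  have hphi : DifferentiableAt ℂ (phi₁ a b) (rectPoint a b c m σ) := by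
    unfold phi₁
    fun_prop
  rw [← phi₁_rectPoint] at hinv
  have hcomp := hinv.differentiableAt.comp _ hphi
  have hσ' : Function.invFunOn (zOfSigma a b c m) (sigmaDomain m)
      (phi₁ a b (rectPoint a b c m σ)) = σ := by
    rw [phi₁_rectPoint, leftInvOn_invFunOn_zOfSigma hab hc h hσ]
  have hU : DifferentiableAt ℂ (diskCoord m) (Function.invFunOn (zOfSigma a b c m)
      (sigmaDomain m) (phi₁ a b (rectPoint a b c m σ))) := by
    rw [hσ']
    exact (hasDerivAt_diskCoord hm
      (diskDen_pos hm hσ.1.le hσ.2.1.le hσ.2.2.1.le hσ.2.2.2.1.le).ne').differentiableAt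
  refine (DifferentiableAt.fun_inv (DifferentiableAt.comp _
    (f := Function.invFunOn (zOfSigma a b c m) (sigmaDomain m) ∘ phi₁ a b) hU
    hcomp) ?_).differentiableWithinAt
  simp only [Function.comp_apply]
  rw [hσ']
  exact diskCoord_ne_zero hm hσ

lemma rectPsi_inv_diskCoord (hab : a < b) (hc : 0 < c) (h : IsRectParameter a b c m) {σ : ℂ}
    (hσ : σ ∈ sigmaDomain m) :
    rectPsi a b c m (diskCoord m σ)⁻¹ = rectPoint a b c m σ := by
  rw [← rectPhi_rectPoint hab hc h hσ]
  exact (bijOn_rectPhi hab hc h).injOn.leftInvOn_invFunOn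
    ((bijOn_rectPoint hab hc h).mapsTo hσ)

/-! ### The leftmost point of a level curve -/

lemma diskCoord_re (m : ℝ) (σ : ℂ) :
    (diskCoord m σ).re = realDn m σ.re * realCn (1 - m) σ.im / diskDen m σ := by
  rw [diskCoord, Complex.add_re, Complex.ofReal_re, Complex.I_mul_re, Complex.ofReal_im, neg_zero,
    add_zero]

lemma diskCoord_im (m : ℝ) (σ : ℂ) :
    (diskCoord m σ).im = √m * realSn m σ.re / diskDen m σ := by
  rw [diskCoord, Complex.add_im, Complex.ofReal_im, Complex.I_mul_im, Complex.ofReal_re, zero_add]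

lemma jacobiCn_im (m : ℝ) (σ : ℂ) : (jacobiCn m σ).im =
    -(realSn m σ.re * realDn m σ.re * realSn (1 - m) σ.im * realDn (1 - m) σ.im) /
      jacobiDen m σ := by
  rw [jacobiCn, Complex.div_ofReal_im, Complex.sub_im, Complex.ofReal_im, Complex.I_mul_im,
    Complex.ofReal_re, zero_sub]

lemma rectPsi_neg (hab : a < b) (hc : 0 < c) (h : IsRectParameter a b c m) {r : ℝ} (hr : 1 < r) :
    rectPsi a b c m (-(r : ℂ)) =
      ((a - 1 / rectLambda c m *
        ∫ t in (0 : ℝ)..((r - 1 / r) / 2), √(m + t ^ 2) / √(1 + t ^ 2) : ℝ) : ℂ) := by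
  have hm : m ∈ Set.Ioo (0 : ℝ) 1 := ⟨h.1, h.2.1⟩
  have hm' := one_sub_mem_Ioo hm
  have hK := completeK_pos hm
  have hK' := completeK_pos hm'
  have hl := rectLambda_pos hc h
  have hr0 : 0 < r := by linarith
  have hk : 0 < √m := Real.sqrt_pos.2 hm.1
  obtain ⟨σ, hσ, e⟩ := exists_diskCoord_eq_inv hm (u := -(r : ℂ)) (by
    rw [norm_neg, Complex.norm_real, Real.norm_of_nonneg hr0.le]; exact hr)
  obtain ⟨h1, h2, h3, h4, h5⟩ := id hσ
  have hP := diskDen_pos hm h1.le h2.le h3.le h4.le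
  have e' : diskCoord m σ = ((-r⁻¹ : ℝ) : ℂ) := by
    rw [e]
    push_cast
    rw [inv_neg]
  have hre := congrArg Complex.re e'
  have him := congrArg Complex.im e'
  rw [diskCoord_re, Complex.ofReal_re] at hre
  rw [diskCoord_im, Complex.ofReal_im] at him
  have hs : realSn m σ.re = 0 := by
    have := (div_eq_zero_iff.1 him).resolve_right hP.ne'
    exact (mul_eq_zero.1 this).resolve_left hk.ne'
  have hx : σ.re = 0 := by
    by_contra hne
    have hlt : |σ.re| < completeK m := abs_lt.2 ⟨h1, h2⟩
    have := realSn_pos hm (abs_pos.2 hne) (by linarith)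
    rw [realSn_abs hm h1.le h2.le, hs, abs_zero] at this
    exact lt_irrefl _ this
  -- `y` is the distance of `σ` from the upper side of the rectangle.
  obtain ⟨y, hy⟩ : ∃ y, σ.im = 2 * completeK (1 - m) - y := ⟨2 * completeK (1 - m) - σ.im, by ring⟩
  unfold diskDen at hre hP
  rw [hx, hy, realCn_zero hm, realSn_two_mul_completeK_sub hm',
    realDn_two_mul_completeK_sub hm', mul_one] at hP
  rw [hx, hy, realDn_zero hm, realCn_zero hm, realSn_two_mul_completeK_sub hm',
    realDn_two_mul_completeK_sub hm', realCn_two_mul_completeK_sub hm', one_mul, mul_one, neg_div,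
    neg_inj, div_eq_iff hP.ne'] at hre
  have hc1 : 0 < realCn (1 - m) y := by rw [hre]; positivity
  have hy1 : y < completeK (1 - m) := by
    by_contra! hle
    have := realCn_nonneg hm' (x := 2 * completeK (1 - m) - y) (by linarith) (by linarith)
    rw [realCn_two_mul_completeK_sub hm'] at this
    linarith
  have hT : √m * realSn (1 - m) y / realCn (1 - m) y = (r - 1 / r) / 2 := by
    have e3 := realSn_sq_add_realCn_sq (1 - m) y
    have e4 := realDn_sq hm' y
    have e5 : √m ^ 2 = m := Real.sq_sqrt hm.1.le
    have hprod : (realDn (1 - m) y - √m * realSn (1 - m) y) *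
        (realDn (1 - m) y + √m * realSn (1 - m) y) = realCn (1 - m) y ^ 2 := by
      linear_combination e4 - realSn (1 - m) y ^ 2 * e5 - e3
    have hp : realDn (1 - m) y + √m * realSn (1 - m) y = r * realCn (1 - m) y := by
      rw [hre]
      field_simp
    rw [hp] at hprod
    have hq : realDn (1 - m) y - √m * realSn (1 - m) y = realCn (1 - m) y / r := by
      rw [eq_div_iff hr0.ne']
      exact mul_right_cancel₀ hc1.ne' (by linear_combination hprod)
    rw [div_eq_iff hc1.ne']
    linear_combination hp / 2 - hq / 2
  have hψ : rectPsi a b c m (-(r : ℂ)) = rectPoint a b c m σ := by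
    rw [← rectPsi_inv_diskCoord hab hc h hσ, e, inv_inv]
  have e2 := rectLambda_mul' hab h
  rw [hψ]
  refine Complex.ext ?_ ?_
  · rw [rectPoint_re hm hσ, hx, hy, epsIm_two_mul_completeK_sub hm,
      epsIm_zero_eq_integral hm (by linarith) hy1, hT, ← e2, Complex.ofReal_re]
    field_simp
    ring
  · rw [rectPoint_im hm hσ, hx, epsRe_zero hm, zero_div, neg_zero, Complex.ofReal_im]

/-- Along the circle `u = e^{-iθ} / ρ` the real part of `Ψ̃(u)` decreases for `0 < θ < π` and
increases for `-π < θ < 0`, because its derivative is `(√m / λ) Im cn`. -/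
lemma lt_re_rectPoint (hc : 0 < c) (h : IsRectParameter a b c m) {σ τ : ℂ} {ρ : ℝ}
    (hσ : σ ∈ sigmaDomain m) (hτ : τ ∈ sigmaDomain m) (hρ : 0 < ρ)
    (hτρ : diskCoord m τ = -(ρ : ℂ)) (hσρ : ‖diskCoord m σ‖ = ρ) (hne : σ ≠ τ) :
    (rectPoint a b c m τ).re < (rectPoint a b c m σ).re := by
  have hm : m ∈ Set.Ioo (0 : ℝ) 1 := ⟨h.1, h.2.1⟩
  have hm' := one_sub_mem_Ioo hm
  have hK := completeK_pos hm
  have hl := rectLambda_pos hc h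
  have hl' : (rectLambda c m : ℂ) ≠ 0 := by exact_mod_cast hl.ne'
  have hk : 0 < √m := Real.sqrt_pos.2 hm.1
  have hk' : ((√m : ℝ) : ℂ) ≠ 0 := by exact_mod_cast hk.ne'
  have hkm : ((√m : ℝ) : ℂ) ^ 2 = m := by
    rw [← Complex.ofReal_pow, Real.sq_sqrt hm.1.le]
  have hρ1 : ρ < 1 := by
    rw [← hσρ]
    exact norm_diskCoord_lt_one hm hσ.1 hσ.2.1 hσ.2.2.1 hσ.2.2.2.1
  have hbij := bijOn_diskCoord hm
  obtain ⟨g, hg⟩ : ∃ g, g = Function.invFunOn (diskCoord m) (sigmaRect m) := ⟨_, rfl⟩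
  have hgl : Set.LeftInvOn g (diskCoord m) (sigmaRect m) := by
    rw [hg]
    exact hbij.injOn.leftInvOn_invFunOn
  -- the point of the rectangle with `diskCoord = ρ e^{iθ}`
  have hpt : ∀ θ : ℝ, g (ρ * Complex.exp (θ * Complex.I)) ∈ sigmaDomain m ∧
      diskCoord m (g (ρ * Complex.exp (θ * Complex.I))) = ρ * Complex.exp (θ * Complex.I) := by
    intro θ
    have hnorm : ‖(ρ : ℂ) * Complex.exp (θ * Complex.I)‖ = ρ := by
      rw [norm_mul, Complex.norm_exp_ofReal_mul_I, mul_one, Complex.norm_real,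
        Real.norm_of_nonneg hρ.le]
    obtain ⟨υ, hυ, e⟩ := hbij.surjOn (show (ρ : ℂ) * Complex.exp (θ * Complex.I) ∈
      Metric.ball (0 : ℂ) 1 by rw [mem_ball_zero_iff, hnorm]; exact hρ1)
    rw [← e, hgl hυ]
    refine ⟨mem_sigmaDomain_iff.2 ⟨hυ, ?_⟩, rfl⟩
    rintro rfl
    have h0 : diskCoord m (Complex.I * (completeK (1 - m) : ℂ)) = 0 := by
      simp [diskCoord, realCn_completeK hm', realSn_zero hm]
    rw [← e, h0, norm_zero] at hnorm
    exact hρ.ne hnorm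
  have hder : ∀ θ : ℝ, HasDerivAt
      (fun θ : ℝ => (rectPoint a b c m (g (ρ * Complex.exp (θ * Complex.I)))).re)
      (√m / rectLambda c m * (jacobiCn m (g (ρ * Complex.exp (θ * Complex.I)))).im) θ := by
    intro θ
    obtain ⟨hυ, hU⟩ := hpt θ
    obtain ⟨υ, hυdef⟩ : ∃ υ, υ = g (ρ * Complex.exp (θ * Complex.I)) := ⟨_, rfl⟩
    rw [← hυdef] at hυ hU ⊢
    have hυR := (mem_sigmaDomain_iff.1 hυ).1
    have hD := (jacobiDen_pos_of_mem hm hυ).ne'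
    have hU0 := diskCoord_ne_zero hm hυ
    have hcn : jacobiCn m υ ≠ 0 := fun h0 => mul_jacobiCn_sq_ne_zero hm hυ (by rw [h0]; simp)
    have d1 : HasDerivAt (fun θ : ℝ => (ρ : ℂ) * Complex.exp (θ * Complex.I))
        (diskCoord m υ * Complex.I) θ := by
      rw [hU]
      have := (((hasDerivAt_id' θ).ofReal_comp.mul_const Complex.I).cexp).const_mul (ρ : ℂ)
      refine this.congr_deriv ?_
      push_cast
      ring
    have d2 := hasDerivAt_of_leftInvOn (isOpen_sigmaRect m)
      (fun w hw => hasDerivAt_diskCoord hm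
        (diskDen_pos hm hw.1.le hw.2.1.le hw.2.2.1.le hw.2.2.2.le).ne')
      (fun w hw => diskCoordDeriv_ne_zero hm hw) hgl hυR
    rw [hU] at d2
    have d3 := (hasDerivAt_zOfSigma (a := a) (b := b) (c := c) hm hυ).add_const
      (((a + b) / 2 : ℝ) : ℂ)
    have d4 := d2.scomp θ d1
    have d5 := (show HasDerivAt (rectPoint a b c m) _ (g (ρ * Complex.exp (θ * Complex.I))) by
      rw [← hυdef]; exact d3).scomp θ d4
    have d6 := Complex.reCLM.hasFDerivAt.comp_hasDerivAt θ d5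
    refine d6.congr_deriv ?_
    have e : diskCoord m υ * Complex.I *
        (Complex.I * (√m : ℝ) * jacobiCn m υ * diskCoord m υ)⁻¹ *
        -(Complex.I / (rectLambda c m : ℂ) * ((m : ℂ) * jacobiCn m υ ^ 2)) =
        ((√m / rectLambda c m : ℝ) : ℂ) * (-Complex.I * jacobiCn m υ) := by
      rw [← hkm]
      push_cast
      field_simp
    rw [diskCoordDeriv_eq hm hD, Complex.reCLM_apply, smul_eq_mul, smul_eq_mul, e,
      Complex.re_ofReal_mul, neg_mul, Complex.neg_re, Complex.I_mul_re, neg_neg]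
  have hsign : ∀ θ : ℝ, ∃ q > 0,
      (jacobiCn m (g (ρ * Complex.exp (θ * Complex.I)))).im = -(q * Real.sin θ) := by
    intro θ
    obtain ⟨hυ, hU⟩ := hpt θ
    generalize g (ρ * Complex.exp (θ * Complex.I)) = υ at *
    have hD := jacobiDen_pos_of_mem hm hυ
    have hP := diskDen_pos hm hυ.1.le hυ.2.1.le hυ.2.2.1.le hυ.2.2.2.1.le
    have him := congrArg Complex.im hU
    rw [diskCoord_im, Complex.im_ofReal_mul, Complex.exp_ofReal_mul_I_im] at him
    have hs : realSn m υ.re = ρ * Real.sin θ * diskDen m υ / √m := by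
      rw [← him]
      field_simp
    refine ⟨ρ * diskDen m υ / √m * realDn m υ.re * realSn (1 - m) υ.im * realDn (1 - m) υ.im /
      jacobiDen m υ, ?_, ?_⟩
    · have := realDn_pos hm υ.re
      have := realDn_pos hm' υ.im
      have := realSn_pos hm' hυ.2.2.1 hυ.2.2.2.1
      positivity
    · rw [jacobiCn_im, hs]
      ring
  have hkl : 0 < √m / rectLambda c m := div_pos hk hl
  have hcont : Continuous fun θ : ℝ =>
      (rectPoint a b c m (g (ρ * Complex.exp (θ * Complex.I)))).re :=
    continuous_iff_continuousAt.2 fun θ => (hder θ).continuousAt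
  have hanti : StrictAntiOn (fun θ : ℝ =>
      (rectPoint a b c m (g (ρ * Complex.exp (θ * Complex.I)))).re) (Set.Icc 0 Real.pi) := by
    refine strictAntiOn_of_deriv_neg (convex_Icc _ _) hcont.continuousOn fun θ hθ => ?_
    rw [interior_Icc] at hθ
    obtain ⟨q, hq, e⟩ := hsign θ
    rw [(hder θ).deriv, e, mul_neg, neg_lt_zero]
    exact mul_pos hkl (mul_pos hq (Real.sin_pos_of_mem_Ioo hθ))
  have hmono : StrictMonoOn (fun θ : ℝ =>
      (rectPoint a b c m (g (ρ * Complex.exp (θ * Complex.I)))).re) (Set.Icc (-Real.pi) 0) := by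
    refine strictMonoOn_of_deriv_pos (convex_Icc _ _) hcont.continuousOn fun θ hθ => ?_
    rw [interior_Icc] at hθ
    obtain ⟨q, hq, e⟩ := hsign θ
    rw [(hder θ).deriv, e, ← mul_neg]
    exact mul_pos hkl (mul_pos hq (neg_pos.2 (Real.sin_neg_of_neg_of_neg_pi_lt hθ.2 hθ.1)))
  have hg1 : g (ρ * Complex.exp ((Real.pi : ℝ) * Complex.I)) = τ := by
    rw [Complex.exp_pi_mul_I, mul_neg_one, ← hτρ, hgl (mem_sigmaDomain_iff.1 hτ).1]
  have hg2 : g (ρ * Complex.exp ((-Real.pi : ℝ) * Complex.I)) = τ := by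
    rw [Complex.ofReal_neg, neg_mul, Complex.exp_neg, Complex.exp_pi_mul_I, inv_neg, inv_one,
      mul_neg_one, ← hτρ, hgl (mem_sigmaDomain_iff.1 hτ).1]
  have hg3 : g (ρ * Complex.exp ((Complex.arg (diskCoord m σ) : ℝ) * Complex.I)) = σ := by
    rw [← hσρ, Complex.norm_mul_exp_arg_mul_I, hgl (mem_sigmaDomain_iff.1 hσ).1]
  have hlt := Complex.neg_pi_lt_arg (diskCoord m σ)
  have hle := Complex.arg_le_pi (diskCoord m σ)
  have hpi := Real.pi_pos
  rcases le_total 0 (Complex.arg (diskCoord m σ)) with h0 | h0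
  · have hlt' : Complex.arg (diskCoord m σ) < Real.pi := lt_of_le_of_ne hle fun e =>
      hne (by rw [← hg3, e, hg1])
    have := hanti ⟨h0, hle⟩ ⟨hpi.le, le_rfl⟩ hlt'
    simpa only [hg1, hg3] using this
  · have := hmono ⟨le_rfl, by linarith⟩ ⟨hlt.le, h0⟩ hlt
    simpa only [hg2, hg3] using this

lemma lt_re_of_mem_levelCurve (hab : a < b) (hc : 0 < c) (h : IsRectParameter a b c m) {r : ℝ}
    (hr : 1 < r) {z : ℂ} (hz : z ∈ levelCurve a b c m r) (hne : z ≠ rectPsi a b c m (-(r : ℂ))) :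
    (rectPsi a b c m (-(r : ℂ))).re < z.re := by
  have hm : m ∈ Set.Ioo (0 : ℝ) 1 := ⟨h.1, h.2.1⟩
  have hr0 : 0 < r := by linarith
  obtain ⟨u, hu, rfl⟩ := hz
  have hu' : ‖u‖ = r := hu
  obtain ⟨σ, hσ, e⟩ := exists_diskCoord_eq_inv hm (u := u) (by rw [hu']; exact hr)
  obtain ⟨τ, hτ, e'⟩ := exists_diskCoord_eq_inv hm (u := -(r : ℂ)) (by
    rw [norm_neg, Complex.norm_real, Real.norm_of_nonneg hr0.le]; exact hr)
  have h1 : rectPsi a b c m u = rectPoint a b c m σ := by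
    rw [← rectPsi_inv_diskCoord hab hc h hσ, e, inv_inv]
  have h2 : rectPsi a b c m (-(r : ℂ)) = rectPoint a b c m τ := by
    rw [← rectPsi_inv_diskCoord hab hc h hτ, e', inv_inv]
  rw [h1, h2] at hne ⊢
  refine lt_re_rectPoint hc h (ρ := r⁻¹) hσ hτ (inv_pos.2 hr0) ?_ ?_ fun e => hne (by rw [e])
  · rw [e', inv_neg, Complex.ofReal_inv]
  · rw [e, norm_inv, hu']

end

theorem mainTheorem8 (a b c : ℝ) (hab : a < b) (hc : 0 < c) :
    (∃! m : ℝ, IsRectParameter a b c m) ∧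
    ∀ m : ℝ, IsRectParameter a b c m →
      (DifferentiableOn ℂ (rectPhi a b c m) (rectExterior a b c) ∧
        Set.BijOn (rectPhi a b c m) (rectExterior a b c) {u : ℂ | 1 < ‖u‖}) ∧
      ∀ r : ℝ, 1 < r →
        rectPsi a b c m (-(r : ℂ)) =
            ((a - 1 / rectLambda c m *
              ∫ t in (0 : ℝ)..((r - 1 / r) / 2), √(m + t ^ 2) / √(1 + t ^ 2) : ℝ) : ℂ) ∧
          IsLeast (Complex.re '' levelCurve a b c m r) (rectPsi a b c m (-(r : ℂ))).re ∧
          ∀ z ∈ levelCurve a b c m r, z ≠ rectPsi a b c m (-(r : ℂ)) →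
            (rectPsi a b c m (-(r : ℂ))).re < z.re := by
  refine ⟨existsUnique_isRectParameter hab hc, fun m h =>
    ⟨⟨differentiableOn_rectPhi hab hc h, bijOn_rectPhi hab hc h⟩, fun r hr =>
      ⟨rectPsi_neg hab hc h hr, ⟨?_, ?_⟩,
        fun z hz hne => lt_re_of_mem_levelCurve hab hc h hr hz hne⟩⟩⟩
  · refine ⟨_, ⟨-(r : ℂ), ?_, rfl⟩, rfl⟩
    rw [Set.mem_ofPred_eq, norm_neg, Complex.norm_real, Real.norm_of_nonneg (by linarith)]
  · rintro _ ⟨z, hz, rfl⟩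
    by_cases hne : z = rectPsi a b c m (-(r : ℂ))
    · rw [hne]
    · exact (lt_re_of_mem_levelCurve hab hc h hr hz hne).le
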